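/- **Setting.** On a probability space let $Y_0,Y_1,V,\Theta$ be real random variables, $\Delta=Y_1-Y_0$, $Y=Y_0+\Delta D$, and let $X=X_D$ be a vector of control variables with $X_0=X_1$ a.s. Either ($L=1$) $D=\mathbf 1\{V-\Theta>0\}$, or ($L\ge 2$) there are random vectors $Z,\Gamma$ in $\mathbb R^{L-1}$ with $D=\mathbf 1\{V-Z'\Gamma-\Theta>0\}$; in the latter case put $\widetilde S=(Z',1)'/\|(Z',1)\|\in\mathbb S^{L-1}$, $\widetilde V=V/\|(Z',1)\|$, $\widetilde\Gamma=(\Gamma',\Theta)'$ and $H^+=\{s\in\mathbb S^{L-1}: s_L>0\}$. When $L=1$ drop $Z,\Gamma,\widetilde S$ below and read $\widetilde V=V$, $\widetilde\Gamma=\Theta$. Write $\mathrm{UCDITE}(\cdot,\gamma,x)=f_{\Delta|\widetilde\Gamma,X}(\cdot|\gamma,x)$ for the conditional density of $\Delta$ given $\widetilde\Gamma=\gamma$, $X=x$. For a function of $v$ or $(s,v)$ let $\overline{\,\cdot\,}$ denote extension by $0$ outside the support of $V$, resp. $(\widetilde S,\widetilde V)$, given $X=x$; regression functions on that support are taken in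 their continuous version. For $f\in L^1(\mathbb R^L)$ let $R[f](s,u)$ be the integral of $f$ over the hyperplane $\{\gamma: s'\gamma=u\}$ with respect to its Lebesgue measure, $(s,u)\in H^+\times\mathbb R$, and let $R^{-1}$ be its inverse (with values taken as limits of averages over small balls). **Assumptions.** 1. For almost every $x$, the conditional law of $(\widetilde S,\widetilde V,Y_0,Y_1,\Theta,\Gamma)$ given $X=x$ is absolutely continuous with respect to the product of the spherical measure and Lebesgue measure on $\mathbb R^{L+3}$; $(V,Z)\perp(Y_0,\Gamma,\Theta)\,|\,X$ and $(V,Z)\perp(Y_1,\Gamma,\Theta)\,|\,X$; $0<\mathbb P(D=1|X)<1$ a.s. 2. $Y_0\perp\Delta\,|\,\widetilde\Gamma,X$. 3. For almost every $x$ and almost every $\gamma$ in $\mathrm{supp}(f_{\widetilde\Gamma|X}(\cdot|x))$, $\mathrm{UCDITE}(\cdot,\gamma,x)\in L^1(\mathbb R)\cap L^2(\mathbb R)$. 4. For almost every $x$ and almost every $\gamma$ in $\mathrm{supp}(f_{\widetilde\Gamma|X}(\cdot|x))$, the characteristic function of $Y_0$ given $\widetilde\Gamma=\gamma$, $X=x$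 has no zero. 5. (Only for $L\ge2$.) For almost every $x$, $\mathrm{supp}(f_{\widetilde S|X}(\cdot|x))=\overline{H^+}$ and, for almost every $s\in H^+$ (with respect to the law of $\widetilde S$ given $X=x$), $\mathrm{supp}(f_{\widetilde V|\widetilde S,X}(\cdot|s,x))\supset[\inf_\gamma s'\gamma,\sup_\gamma s'\gamma]\cap\mathbb R$, the infimum and supremum being over $\gamma\in\mathrm{supp}(f_{\widetilde\Gamma|X}(\cdot|x))$. **Conclusion.** The conditional density of treatment effects is identified: it is the following functional of the conditional law of the observables given $X=x$. *Case $L=1$.* For almost every $x$ and for almost every $\theta$ (with respect to the conditional law of $\Theta$ given $X=x$) lying in $\mathrm{supp}(f_{V|X}(\cdot|x))$ (hence for almost every $\theta$, if this support contains that of $f_{\Theta|X}(\cdot|x)$), the conditional law of $\Delta$ given $\Theta=\theta$, $X=x$ has a density and $$\mathrm{UCDITE}(\delta,\theta,x)=\frac1{2\pi}\int_{-\infty}^{\infty}e^{-it\delta}\,\frac{\overline{\partial_v\mathbb E[e^{itY}D\,|\,V=\cdot,X=x]}(\theta)}{\overline{\partial_v\mathbb E[e^{itY}(D-1)\,|\,V=\cdot,X=x]}(\theta)}\,dt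 .$$ *Case $L\ge2$.* For almost every $x$ and for almost every $\gamma$ (with respect to the conditional law of $\widetilde\Gamma$ given $X=x$), the conditional law of $\Delta$ given $\widetilde\Gamma=\gamma$, $X=x$ has a density and $$\mathrm{UCDITE}(\delta,\gamma,x)=\frac1{2\pi}\int_{-\infty}^{\infty}e^{-it\delta}\,\frac{R^{-1}\big[\overline{\partial_v\mathbb E[e^{itY}D\,|\,(\widetilde S,\widetilde V)=\cdot,X=x]}\big](\gamma)}{R^{-1}\big[\overline{\partial_v\mathbb E[e^{itY}(D-1)\,|\,(\widetilde S,\widetilde V)=\cdot,X=x]}\big](\gamma)}\,dt .$$ Both formulas are inverse Fourier transforms in $L^2(\mathbb R)$, as functions of $\delta$: the ratio is a square-integrable function of $t$ and the integrals over $[-T,T]$ converge to $\mathrm{UCDITE}$ in $L^2(\mathbb R,d\delta)$ as $T\to\infty$; if the ratio is integrable in $t$, the formula also holds with a Lebesgue integral for almost every $\delta$. -/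

import Mathlib

open MeasureTheory ProbabilityTheory Filter Topology Set
open scoped ENNReal

noncomputable section

/-! ### Conditional independence given a random variable -/

/-- `A ⊥ B | C`: the joint conditional law of `(A, B)` given `C = c` is the product of the
conditional laws of `A` and of `B` given `C = c`, for almost every `c`. -/
def CondIndepGiven {Ω α β κ : Type*} [MeasurableSpace Ω] [MeasurableSpace α] [MeasurableSpace β]
    [MeasurableSpace κ] [StandardBorelSpace α] [Nonempty α] [StandardBorelSpace β] [Nonempty β]
    (μ : Measure Ω) [IsFiniteMeasure μ] (A : Ω → α) (B : Ω → β) (C : Ω → κ) : Prop :=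
  ∀ᵐ c ∂(μ.map C),
    condDistrib (fun ω => (A ω, B ω)) C μ c = (condDistrib A C μ c).prod (condDistrib B C μ c)

/-- On a standard Borel sample space this is Mathlib's conditional independence. -/
theorem condIndepGiven_iff {Ω α β κ : Type*} [MeasurableSpace Ω] [StandardBorelSpace Ω]
    [MeasurableSpace α] [MeasurableSpace β] [MeasurableSpace κ]
    [StandardBorelSpace α] [Nonempty α] [StandardBorelSpace β] [Nonempty β]
    (μ : Measure Ω) [IsFiniteMeasure μ] {A : Ω → α} {B : Ω → β} {C : Ω → κ}
    (hA : Measurable A) (hB : Measurable B) (hC : Measurable C) :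
    CondIndepGiven μ A B C ↔ A ⟂ᵢ[C, hC; μ] B := by
  rw [condIndepFun_iff_map_prod_eq_prod_condDistrib_prod_condDistrib hA hB hC,
    ← Measure.compProd_eq_comp_prod,
    ← condDistrib_ae_eq_iff_measure_eq_compProd C (hA.prodMk hB).aemeasurable]
  unfold CondIndepGiven
  simp only [Filter.EventuallyEq, Kernel.prod_apply]

/-! ### Regression functions and their derivatives

`Q` is a joint law of `(Y, D, U)`, where `U` takes values in `T`. -/

/-- The regression function `u ↦ E[w(Y, D) | U = u]`, in its version that is continuous on the
support of the law of `U`. Two such versions agree on the support. -/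
def regression {T : Type*} [TopologicalSpace T] [MeasurableSpace T]
    (Q : Measure (ℝ × ℝ × T)) (w : ℝ → ℝ → ℂ) : T → ℂ :=
  open Classical in
  if h : ∃ g : T → ℂ, ContinuousOn g (Q.map fun p => p.2.2).support ∧
      (fun p => g p.2.2) =ᵐ[Q]
        Q[fun p => w p.1 p.2.1 | MeasurableSpace.comap (fun p : ℝ × ℝ × T => p.2.2) inferInstance]
  then h.choose else 0

/-- `∂_v E[w(Y, D) | V = ·]`, extended by `0` outside the support of `V`. -/
def dvRegression (Q : Measure (ℝ × ℝ × ℝ)) (w : ℝ → ℝ → ℂ) (v : ℝ) : ℂ :=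
  let S : Set ℝ := (Q.map fun p => p.2.2).support
  open Classical in
  if v ∈ S then derivWithin (regression Q w) S v else 0

/-- `∂_v E[w(Y, D) | (S, V) = ·]` with `S` in a space of directions `𝕊` and `V` real, extended by
`0` outside the support of `(S, V)`. -/
def dvRegressionDir {𝕊 : Type*} [TopologicalSpace 𝕊] [MeasurableSpace 𝕊]
    (Q : Measure (ℝ × ℝ × 𝕊 × ℝ)) (w : ℝ → ℝ → ℂ) (p : 𝕊 × ℝ) : ℂ :=
  let S : Set (𝕊 × ℝ) := (Q.map fun p => p.2.2).support
  open Classical in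
  if p ∈ S then derivWithin (fun u => regression Q w (p.1, u)) {u | (p.1, u) ∈ S} p.2 else 0

/-- `(y, d) ↦ e^{ity} d`. -/
def treatedWeight (t : ℝ) (y d : ℝ) : ℂ := Complex.exp (Complex.I * t * y) * d

/-- `(y, d) ↦ e^{ity} (d - 1)`. -/
def untreatedWeight (t : ℝ) (y d : ℝ) : ℂ := Complex.exp (Complex.I * t * y) * (d - 1)

/-! ### The Radon transform on `ℝ^{d+1}` -/

/-- `ℝ^n` with its Euclidean structure. -/
abbrev Eu (n : ℕ) : Type := EuclideanSpace ℝ (Fin n)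

/-- The unit sphere of `ℝ^{d+1}`. -/
abbrev Sph (d : ℕ) : Type := Metric.sphere (0 : Eu (d + 1)) 1

instance (d : ℕ) : StandardBorelSpace (Sph d) :=
  Metric.isClosed_sphere.measurableSet.standardBorel

instance (d : ℕ) : Nonempty (Sph d) :=
  (NormedSpace.sphere_nonempty.mpr zero_le_one).to_subtype

/-- The surface measure of the sphere. -/
def sphMeasure (d : ℕ) : Measure (Sph d) := (volume : Measure (Eu (d + 1))).toSphere

/-- The open hemisphere of directions whose last coordinate is positive. -/
def Hplus (d : ℕ) : Set (Sph d) := {s | 0 < (s : Eu (d + 1)) (Fin.last d)}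

/-- The integral of `f` over the hyperplane `{γ | ⟪s, γ⟫ = u}` (`s` a unit vector), with respect
to the Lebesgue measure of this hyperplane: it is parametrized by `y ↦ u s + y`, with `y` in the
orthogonal complement of `s`, where the Lebesgue measure gives mass `1` to the unit cube of an
orthonormal basis. -/
def radon {d : ℕ} (f : Eu (d + 1) → ℂ) (s : Sph d) (u : ℝ) : ℂ :=
  ∫ y : (Submodule.span ℝ {(s : Eu (d + 1))})ᗮ, f (u • (s : Eu (d + 1)) + y)
    ∂(stdOrthonormalBasis ℝ (Submodule.span ℝ {(s : Eu (d + 1))})ᗮ).toBasis.addHaar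

/-- `f` is an integrable function whose Radon transform is `h`, almost everywhere on `H⁺ × ℝ`. -/
def IsInvRadon {d : ℕ} (h : Sph d × ℝ → ℂ) (f : Eu (d + 1) → ℂ) : Prop :=
  Integrable f ∧
    ∀ᵐ s ∂((sphMeasure d).restrict (Hplus d)), ∀ᵐ u : ℝ, radon f s u = h (s, u)

/-- The inverse Radon transform of `h`. The integrable `f` with Radon transform `h` is unique up to
a null set; its value at a point is taken to be the limit of its averages over small balls, which
does not depend on the representative and equals `f` almost everywhere. -/
def invRadon {d : ℕ} (h : Sph d × ℝ → ℂ) (γ : Eu (d + 1)) : ℂ :=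
  open Classical in
  if hf : ∃ f : Eu (d + 1) → ℂ, IsInvRadon h f then
    limUnder (𝓝[>] (0 : ℝ)) fun r => ⨍ y in Metric.closedBall γ r, hf.choose y
  else 0

/-! ### Rescaled instruments and coefficients -/

/-- The vector `(z', a)'`. -/
def snocVec {d : ℕ} (z : Eu d) (a : ℝ) : Eu (d + 1) :=
  WithLp.toLp 2 (Fin.snoc (α := fun _ => ℝ) (fun i => z i) a)

theorem snocVec_one_ne_zero {d : ℕ} (z : Eu d) : snocVec z 1 ≠ 0 := by
  intro h
  have := congrArg (fun v : Eu (d + 1) => v (Fin.last d)) h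
  simp [snocVec] at this

/-- `(z', 1)' / ‖(z', 1)‖`. -/
def sTilde {d : ℕ} (z : Eu d) : Sph d :=
  ⟨‖snocVec z 1‖⁻¹ • snocVec z 1, by
    simp [norm_smul, inv_mul_cancel₀ (norm_ne_zero_iff.mpr (snocVec_one_ne_zero z))]⟩

/-- `v / ‖(z', 1)‖`. -/
def vTilde {d : ℕ} (v : ℝ) (z : Eu d) : ℝ := v / ‖snocVec z 1‖

/-! ### The distribution of treatment effects given the unobservables -/

/-- `δ ↦ f_{Δ | G, X}(δ | g, x)`: the Lebesgue density of the conditional law of `Δ` given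
`(G, X) = (g, x)`. -/
def UCDITE {Ω 𝒢 𝒳 : Type*} [MeasurableSpace Ω] [MeasurableSpace 𝒢] [MeasurableSpace 𝒳]
    (μ : Measure Ω) [IsFiniteMeasure μ] (Δ : Ω → ℝ) (G : Ω → 𝒢) (X : Ω → 𝒳)
    (δ : ℝ) (g : 𝒢) (x : 𝒳) : ℝ :=
  ((condDistrib Δ (fun ω => (G ω, X ω)) μ (g, x)).rnDeriv volume δ).toReal

/-- `u(δ) = (2π)⁻¹ ∫ e^{-itδ} r(t) dt`, as the inverse Fourier transform on `L²(ℝ)`: `r` is square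
integrable and the integrals over `[-T, T]` converge to `u` in `L²(ℝ)` as `T → ∞`. When `r` is
integrable, the equality also holds with the Lebesgue integral, for almost every `δ`. -/
def IsFourierInversion (u : ℝ → ℝ) (r : ℝ → ℂ) : Prop :=
  MemLp r 2 volume ∧
  Tendsto (fun T : ℝ =>
      eLpNorm (fun δ : ℝ => (u δ : ℂ) -
        (1 / (2 * Real.pi) : ℂ) * ∫ t in (-T)..T, Complex.exp (-(Complex.I * t * δ)) * r t)
        2 volume) atTop (𝓝 0) ∧
  (Integrable r volume → ∀ᵐ δ : ℝ,
    (u δ : ℂ) = (1 / (2 * Real.pi) : ℂ) * ∫ t : ℝ, Complex.exp (-(Complex.I * t * δ)) * r t)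

end

/-! ### Conditional laws given `X = x` -/

section ConditionalLaws

variable {Ω 𝒳 : Type*} [MeasurableSpace Ω] [MeasurableSpace 𝒳] {μ : Measure Ω}
  [IsFiniteMeasure μ] {X : Ω → 𝒳}

/-! Fix `x` and work under the conditional law of all primitives given `X = x`. Treatment occurs
exactly when the unobservable `γ` lies in the half-space `⟪s, γ⟫ < v` (the half-line `θ < v` for a
scalar unobservable). The instruments are independent of (`Y₁`, `γ`), so `E[e^{itY} D | (s, v)]` is
the integral of `φ₁(t | γ) f(γ)` over that half-space, where `φ₁` is the characteristic function of
`Y₁` given `γ` and `f` the density of `γ`. Likewise `E[e^{itY} (D - 1) | (s, v)]` is the half-space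
integral of `φ₀(t | γ) f(γ)`, minus a constant that differentiation in `v` removes
(`regression_treatedWeight`, `regression_untreatedWeight`).

In the scalar case the derivative in `v` is `φ_j(t | θ) f(θ)` by Lebesgue differentiation. In
several dimensions it is the Radon transform of `φ_j f`, which is inverted because the Fourier slice
theorem makes that transform injective on `L¹` (`ae_eq_of_radon_ae_eq`). Extending the derivative by
zero is harmless: away from two endpoints, either the support contains a whole neighbourhood of `v`
in the direction `s`, or the half-space integral is constant near `v`
(`interior_or_eventually_const`).

In the ratio, `f` cancels. Since `Y₁ = Y₀ + Δ` with `Y₀` and `Δ` independent given `γ`, what remains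
is the characteristic function of `Δ` given `γ`, which Plancherel inverts in `L²`
(`isFourierInversion_charFun`).

Two points need care. The exceptional null set of `γ` must not depend on `t`, which is the role of
`ae_forall_tendsto_average_charFun`. And regressions are defined only up to null sets, so continuity
is used to fix their values on the support (`regression_eqOn`). -/

theorem ae_condDistrib_map {α β : Type*} [MeasurableSpace α] [StandardBorelSpace α] [Nonempty α]
    [MeasurableSpace β] [StandardBorelSpace β] [Nonempty β] {W : Ω → α} (hW : Measurable W)
    {f : α → β} (hf : Measurable f) :
    ∀ᵐ x ∂(μ.map X), condDistrib (fun ω => f (W ω)) X μ x = (condDistrib W X μ x).map f := by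
  filter_upwards [condDistrib_comp X hW.aemeasurable hf] with x hx
  rw [← Kernel.map_apply _ hf, ← hx]
  rfl

theorem ae_ae_of_ae_map_prodMk {β : Type*} [MeasurableSpace β] [StandardBorelSpace β] [Nonempty β]
    {B : Ω → β} (hB : Measurable B) (hX : Measurable X) {p : β × 𝒳 → Prop}
    (h : ∀ᵐ q ∂(μ.map fun ω => (B ω, X ω)), p q) :
    ∀ᵐ x ∂(μ.map X), ∀ᵐ b ∂(condDistrib B X μ x), p (b, x) := by
  have hmap : (μ.map fun ω => (B ω, X ω)) = (μ.map fun ω => (X ω, B ω)).map Prod.swap := by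
    rw [Measure.map_map measurable_swap (hX.prodMk hB)]; rfl
  rw [hmap, ← compProd_map_condDistrib hB.aemeasurable] at h
  exact Measure.ae_ae_of_ae_compProd (ae_of_ae_map measurable_swap.aemeasurable h)

/-- Conditioning pairs are written with `X` last, while iterated disintegration puts `X` first; this
reconciles the two orders. -/
theorem map_swap_compProd_comap_swap {α β γ : Type*} [MeasurableSpace α] [MeasurableSpace β]
    [MeasurableSpace γ] (ν : Measure (α × β)) [SFinite ν] (κ : Kernel (α × β) γ)
    [IsSFiniteKernel κ] :
    ν.map Prod.swap ⊗ₘ κ.comap Prod.swap measurable_swap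
      = (ν ⊗ₘ κ).map (Prod.map Prod.swap id) := by
  ext s hs
  have hm : Measurable (Prod.map (Prod.swap : α × β → β × α) (id : γ → γ)) := by fun_prop
  rw [Measure.compProd_apply hs, Measure.map_apply hm hs, Measure.compProd_apply (hm hs),
    lintegral_map (Kernel.measurable_kernel_prodMk_left hs) measurable_swap]
  rfl

/-- Disintegration of the conditional law of a pair given `X = x`. -/
theorem ae_condDistrib_prodMk {α β : Type*} [MeasurableSpace α] [StandardBorelSpace α] [Nonempty α]
    [MeasurableSpace β] [StandardBorelSpace β] [Nonempty β] {A : Ω → α} {B : Ω → β}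
    (hA : Measurable A) (hB : Measurable B) (hX : Measurable X) :
    ∀ᵐ x ∂(μ.map X), condDistrib (fun ω => (B ω, A ω)) X μ x
      = condDistrib B X μ x ⊗ₘ (condDistrib A (fun ω => (B ω, X ω)) μ).sectL x := by
  set η : Kernel (𝒳 × β) α :=
    (condDistrib A (fun ω => (B ω, X ω)) μ).comap Prod.swap measurable_swap with hη
  have key : μ.map (fun ω => (X ω, (B ω, A ω))) = μ.map X ⊗ₘ (condDistrib B X μ ⊗ₖ η) := by
    have h1 : (μ.map fun ω => (X ω, B ω)) = (μ.map fun ω => (B ω, X ω)).map Prod.swap := by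
      rw [Measure.map_map measurable_swap (hB.prodMk hX)]; rfl
    rw [← Measure.compProd_assoc', compProd_map_condDistrib hB.aemeasurable, h1,
      map_swap_compProd_comap_swap, compProd_map_condDistrib hA.aemeasurable,
      Measure.map_map (by fun_prop) (by fun_prop), Measure.map_map (by fun_prop) (by fun_prop)]
    rfl
  filter_upwards [condDistrib_ae_eq_of_measure_eq_compProd X (hB.prodMk hA).aemeasurable key]
    with x hx
  rw [hx, Kernel.compProd_apply_eq_compProd_sectR]
  rfl

/-- If `Y₀` and `Δ` are independent given `(G, X)`, the characteristic function of `Y₀ + Δ` given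
`(G, X)` is the product of those of `Y₀` and `Δ`. -/
theorem ae_charFun_condDistrib_add {𝒢 : Type*} [MeasurableSpace 𝒢] {Y₀ Y₁ Δ : Ω → ℝ} {G : Ω → 𝒢}
    (hY₀ : Measurable Y₀) (hΔm : Measurable Δ) (hΔ : ∀ ω, Y₁ ω = Y₀ ω + Δ ω)
    (h : CondIndepGiven μ Y₀ Δ G) :
    ∀ᵐ g ∂(μ.map G), ∀ t, charFun (condDistrib Y₁ G μ g) t
      = charFun (condDistrib Y₀ G μ g) t * charFun (condDistrib Δ G μ g) t := by
  have hY₁ : Y₁ = fun ω => (fun p : ℝ × ℝ => p.1 + p.2) (Y₀ ω, Δ ω) := funext hΔ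
  filter_upwards [h, ae_condDistrib_map (μ := μ) (X := G) (hY₀.prodMk hΔm)
    (f := fun p : ℝ × ℝ => p.1 + p.2) (by fun_prop)] with g hg hg' t
  rw [hY₁, hg', hg, ← charFun_conv]
  rfl

end ConditionalLaws

/-! ### Fourier inversion for square-integrable densities -/

section FourierInversion

open FourierTransform SchwartzMap Complex

/-- The `L²` transform is not given by an integral. Both sides are locally integrable, so testing
against compactly supported smooth functions suffices: on the left this is duality for tempered
distributions, on the right it is Fubini. -/
theorem fourier_toLp_two_ae_eq {f : ℝ → ℂ} (hf₁ : Integrable f) (hf₂ : MemLp f 2 volume) :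
    (𝓕 (hf₂.toLp f) : Lp ℂ 2 (volume : Measure ℝ)) =ᵐ[volume] 𝓕 f := by
  have hcont : Continuous (𝓕 f : ℝ → ℂ) :=
    VectorFourier.fourierIntegral_continuous Real.continuous_fourierChar
      (by fun_prop) hf₁
  refine ae_eq_of_integral_contDiff_smul_eq
    ((Lp.memLp _).locallyIntegrable (by norm_num)) hcont.locallyIntegrable ?_
  intro g hg hgc
  have hg₁ : HasCompactSupport (Complex.ofRealCLM ∘ g) := hgc.comp_left rfl
  have hg₂ : ContDiff ℝ (⊤ : ℕ∞) (Complex.ofRealCLM ∘ g) := by fun_prop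
  set φ : 𝓢(ℝ, ℂ) := hg₁.toSchwartzMap hg₂ with hφ
  have hφg : ∀ x, φ x = (g x : ℂ) := fun x => by simp [hφ]
  have h1 := congrArg (fun T : TemperedDistribution ℝ ℂ => T φ)
    (Lp.fourier_toTemperedDistribution_eq (hf₂.toLp f))
  simp only [TemperedDistribution.fourier_apply, Lp.toTemperedDistribution_apply] at h1
  have h2 : ∫ x, (𝓕 φ : 𝓢(ℝ, ℂ)) x • (hf₂.toLp f) x = ∫ x, (𝓕 φ : 𝓢(ℝ, ℂ)) x • f x := by
    refine integral_congr_ae ?_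
    filter_upwards [hf₂.coeFn_toLp] with x hx
    rw [hx]
  have h3 : ∫ x, (𝓕 φ : 𝓢(ℝ, ℂ)) x • f x = ∫ x, φ x • (𝓕 f : ℝ → ℂ) x := by
    have := VectorFourier.integral_fourierIntegral_smul_eq_flip (μ := volume) (ν := volume)
      (L := innerₗ ℝ) Real.continuous_fourierChar (by fun_prop) φ.integrable hf₁
    rw [flip_innerₗ] at this
    convert! this using 2
  rw [h2, h3] at h1
  calc ∫ x, g x • (𝓕 (hf₂.toLp f) : Lp ℂ 2 (volume : Measure ℝ)) x
      = ∫ x, φ x • (𝓕 (hf₂.toLp f) : Lp ℂ 2 (volume : Measure ℝ)) x := by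
        simp [hφg]
    _ = _ := by rw [← h1]; simp [hφg]

/-- Same duality argument, with the pairing `-⟪·, ·⟫` in the kernel. -/
theorem fourierInv_toLp_two_ae_eq {f : ℝ → ℂ} (hf₁ : Integrable f) (hf₂ : MemLp f 2 volume) :
    (𝓕⁻ (hf₂.toLp f) : Lp ℂ 2 (volume : Measure ℝ)) =ᵐ[volume] 𝓕⁻ f := by
  have hcont : Continuous (𝓕⁻ f : ℝ → ℂ) :=
    VectorFourier.fourierIntegral_continuous Real.continuous_fourierChar
      (by fun_prop) hf₁
  refine ae_eq_of_integral_contDiff_smul_eq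
    ((Lp.memLp _).locallyIntegrable (by norm_num)) hcont.locallyIntegrable ?_
  intro g hg hgc
  have hg₁ : HasCompactSupport (Complex.ofRealCLM ∘ g) := hgc.comp_left rfl
  have hg₂ : ContDiff ℝ (⊤ : ℕ∞) (Complex.ofRealCLM ∘ g) := by fun_prop
  set φ : 𝓢(ℝ, ℂ) := hg₁.toSchwartzMap hg₂ with hφ
  have hφg : ∀ x, φ x = (g x : ℂ) := fun x => by simp [hφ]
  have h1 := congrArg (fun T : TemperedDistribution ℝ ℂ => T φ)
    (Lp.fourierInv_toTemperedDistribution_eq (hf₂.toLp f))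
  simp only [TemperedDistribution.fourierInv_apply, Lp.toTemperedDistribution_apply] at h1
  have h2 : ∫ x, (𝓕⁻ φ : 𝓢(ℝ, ℂ)) x • (hf₂.toLp f) x = ∫ x, (𝓕⁻ φ : 𝓢(ℝ, ℂ)) x • f x := by
    refine integral_congr_ae ?_
    filter_upwards [hf₂.coeFn_toLp] with x hx
    rw [hx]
  have h3 : ∫ x, (𝓕⁻ φ : 𝓢(ℝ, ℂ)) x • f x = ∫ x, φ x • (𝓕⁻ f : ℝ → ℂ) x := by
    have := VectorFourier.integral_fourierIntegral_smul_eq_flip (μ := volume) (ν := volume)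
      (L := -innerₗ ℝ) Real.continuous_fourierChar (by simp; fun_prop) φ.integrable hf₁
    have h' : (-innerₗ ℝ : ℝ →ₗ[ℝ] ℝ →ₗ[ℝ] ℝ).flip = -innerₗ ℝ := by
      ext; simp
    rw [h'] at this
    convert! this using 2
    rw [SchwartzMap.fourierInv_coe]
    rfl
  rw [h2, h3] at h1
  calc ∫ x, g x • (𝓕⁻ (hf₂.toLp f) : Lp ℂ 2 (volume : Measure ℝ)) x
      = ∫ x, φ x • (𝓕⁻ (hf₂.toLp f) : Lp ℂ 2 (volume : Measure ℝ)) x := by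
        simp [hφg]
    _ = _ := by rw [← h1]; simp [hφg]

theorem memLp_two_fourierInv {f : ℝ → ℂ} (hf₁ : Integrable f) (hf₂ : MemLp f 2 volume) :
    MemLp (𝓕⁻ f) 2 volume :=
  (memLp_congr_ae (fourierInv_toLp_two_ae_eq hf₁ hf₂)).mp (Lp.memLp _)

/-- The truncated inversion error is the tail of the transform (Plancherel). -/
theorem eLpNorm_sub_fourier_eq {f h : ℝ → ℂ} (hf₁ : Integrable f) (hf₂ : MemLp f 2 volume)
    (hh₁ : Integrable h) (hh₂ : MemLp h 2 volume) :
    eLpNorm (fun x => f x - 𝓕 h x) 2 volume = eLpNorm (fun x => 𝓕⁻ f x - h x) 2 volume := by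
  have h0 : ‖𝓕⁻ (hf₂.toLp f) - hh₂.toLp h‖ = ‖hf₂.toLp f - 𝓕 (hh₂.toLp h)‖ := by
    rw [← Lp.norm_fourier_eq (𝓕⁻ (hf₂.toLp f) - hh₂.toLp h)]
    congr 1
    have : 𝓕 (𝓕⁻ (hf₂.toLp f) - hh₂.toLp h) = 𝓕 (𝓕⁻ (hf₂.toLp f)) - 𝓕 (hh₂.toLp h) :=
      map_sub (Lp.fourierTransformₗᵢ ℝ ℂ) _ _
    rw [this, fourier_fourierInv_eq]
  have e1 : eLpNorm (fun x => f x - 𝓕 h x) 2 volume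
      = ENNReal.ofReal ‖hf₂.toLp f - 𝓕 (hh₂.toLp h)‖ := by
    rw [Lp.norm_def, ENNReal.ofReal_toReal (Lp.eLpNorm_ne_top _)]
    refine eLpNorm_congr_ae ?_
    filter_upwards [Lp.coeFn_sub (hf₂.toLp f) (𝓕 (hh₂.toLp h)), hf₂.coeFn_toLp,
      fourier_toLp_two_ae_eq hh₁ hh₂] with x h1 h2 h3
    rw [h1, Pi.sub_apply, h2, h3]
  have e2 : eLpNorm (fun x => 𝓕⁻ f x - h x) 2 volume
      = ENNReal.ofReal ‖𝓕⁻ (hf₂.toLp f) - hh₂.toLp h‖ := by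
    rw [Lp.norm_def, ENNReal.ofReal_toReal (Lp.eLpNorm_ne_top _)]
    refine eLpNorm_congr_ae ?_
    filter_upwards [Lp.coeFn_sub (𝓕⁻ (hf₂.toLp f)) (hh₂.toLp h), hh₂.coeFn_toLp,
      fourierInv_toLp_two_ae_eq hf₁ hf₂] with x h1 h2 h3
    rw [h1, Pi.sub_apply, h2, h3]
  rw [e1, e2, h0]

theorem tendsto_eLpNorm_two_sub_indicator {g : ℝ → ℂ} (hg : MemLp g 2 volume) :
    Tendsto (fun T : ℝ => eLpNorm (fun x => g x - (Ioc (-T) T).indicator g x) 2 volume)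
      atTop (𝓝 0) := by
  have hfin : ∫⁻ x, ‖g x‖ₑ ^ (2 : ℝ) ≠ ∞ := by
    have := lintegral_rpow_enorm_lt_top_of_eLpNorm_lt_top (by norm_num) (by norm_num) hg.2
    simpa using this.ne
  have key : Tendsto (fun T : ℝ => ∫⁻ x, ‖g x - (Ioc (-T) T).indicator g x‖ₑ ^ (2 : ℝ))
      atTop (𝓝 (∫⁻ _ : ℝ, 0)) := by
    refine tendsto_lintegral_filter_of_dominated_convergence' (fun x => ‖g x‖ₑ ^ (2 : ℝ))
      (Eventually.of_forall fun T => ?_) (Eventually.of_forall fun T => ?_) hfin ?_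
    · exact ((hg.1.sub (hg.1.indicator measurableSet_Ioc)).enorm).pow_const _
    · refine Eventually.of_forall fun x => ?_
      by_cases hx : x ∈ Ioc (-T) T <;> simp [hx]
    · refine Eventually.of_forall fun x => ?_
      refine tendsto_const_nhds.congr' ?_
      filter_upwards [eventually_gt_atTop |x|] with T hT
      have : x ∈ Ioc (-T) T := ⟨(abs_lt.mp hT).1, (abs_lt.mp hT).2.le⟩
      simp [this]
  rw [lintegral_zero] at key
  have := key.ennrpow_const (1 / 2)
  simp only [one_div, ENNReal.zero_rpow_of_pos (show (0 : ℝ) < 2⁻¹ by norm_num)] at this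
  refine this.congr fun T => ?_
  rw [eLpNorm_eq_lintegral_rpow_enorm_toReal (by norm_num) (by norm_num)]
  simp

/-- The characteristic function of a law with density `u ∈ L¹ ∩ L²` is inverted by the Fourier
integral in `L²`. -/
theorem isFourierInversion_charFun {ρ : Measure ℝ} [IsFiniteMeasure ρ] (hρ : ρ ≪ volume)
    (hu : MemLp (fun δ => (ρ.rnDeriv volume δ).toReal) 2 volume) :
    IsFourierInversion (fun δ => (ρ.rnDeriv volume δ).toReal) (charFun ρ) := by
  set u : ℝ → ℝ := fun δ => (ρ.rnDeriv volume δ).toReal with hu_def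
  have hui : Integrable u := Measure.integrable_toReal_rnDeriv
  set f : ℝ → ℂ := fun δ => (u δ : ℂ) with hf_def
  have hf₁ : Integrable f := hui.ofReal
  have hf₂ : MemLp f 2 volume := hu.ofReal
  set g : ℝ → ℂ := 𝓕⁻ f with hg_def
  have hg₂ : MemLp g 2 volume := memLp_two_fourierInv hf₁ hf₂
  have h2π : (2 * Real.pi) ≠ 0 := by positivity
  -- The characteristic function uses `e^{itx}`, the Fourier transform `e^{2πitx}`; all later
  -- factors `2π` come from this change of scale.
  have hr : ∀ t, charFun ρ t = g (t / (2 * Real.pi)) := by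
    intro t
    rw [charFun_apply_real, hg_def, Real.fourierInv_eq', ← Measure.withDensity_rnDeriv_eq ρ volume hρ,
      integral_withDensity_eq_integral_toReal_smul (Measure.measurable_rnDeriv _ _)
        (Measure.rnDeriv_lt_top _ _)]
    refine integral_congr_ae (Eventually.of_forall fun x => ?_)
    simp only [hf_def, hu_def, smul_eq_mul, Complex.real_smul, RCLike.inner_apply, conj_trivial]
    rw [mul_comm]
    congr 2
    push_cast
    have : (Real.pi : ℂ) ≠ 0 := by exact_mod_cast Real.pi_ne_zero
    field_simp
  have hscale : (fun t => charFun ρ t) = fun t => g ((2 * Real.pi)⁻¹ * t) := by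
    funext t; rw [hr t]; congr 1; ring
  have hmap : Measure.map (fun t : ℝ => (2 * Real.pi)⁻¹ * t) volume
      = ENNReal.ofReal |((2 * Real.pi)⁻¹)⁻¹| • volume :=
    Real.map_volume_mul_left (inv_ne_zero h2π)
  have hint : ∀ (T δ : ℝ), (1 / (2 * Real.pi) : ℂ) *
      ∫ t in (-T)..T, Complex.exp (-(Complex.I * t * δ)) * charFun ρ t
      = ∫ s in (-(T / (2 * Real.pi)))..(T / (2 * Real.pi)),
        Complex.exp (↑(-2 * Real.pi * (s * δ)) * I) * g s := by
    intro T δ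
    have := intervalIntegral.integral_comp_div (a := -T) (b := T)
      (f := fun s : ℝ => Complex.exp (↑(-2 * Real.pi * (s * δ)) * I) * g s) h2π
    rw [neg_div] at this
    have e : ∀ t : ℝ, Complex.exp (-(Complex.I * t * δ)) * charFun ρ t =
        Complex.exp (↑(-2 * Real.pi * (t / (2 * Real.pi) * δ)) * I) * g (t / (2 * Real.pi)) := by
      intro t
      rw [hr]
      congr 2
      push_cast
      have : (Real.pi : ℂ) ≠ 0 := by exact_mod_cast Real.pi_ne_zero
      field_simp
    simp_rw [e]
    rw [this, Complex.real_smul]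
    push_cast
    have : (Real.pi : ℂ) ≠ 0 := by exact_mod_cast Real.pi_ne_zero
    field_simp
    congr 1
    funext x
    ring_nf
  have hintegral : ∀ δ : ℝ, (1 / (2 * Real.pi) : ℂ) *
      ∫ t : ℝ, Complex.exp (-(Complex.I * t * δ)) * charFun ρ t = 𝓕 g δ := by
    intro δ
    have := Measure.integral_comp_mul_left
      (fun s : ℝ => Complex.exp (↑(-2 * Real.pi * (s * δ)) * I) * g s) (2 * Real.pi)⁻¹
    have e : ∀ t : ℝ, Complex.exp (-(Complex.I * t * δ)) * charFun ρ t =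
        Complex.exp (↑(-2 * Real.pi * ((2 * Real.pi)⁻¹ * t * δ)) * I) *
          g ((2 * Real.pi)⁻¹ * t) := by
      intro t
      rw [congrFun hscale t]
      congr 2
      push_cast
      have : (Real.pi : ℂ) ≠ 0 := by exact_mod_cast Real.pi_ne_zero
      field_simp
    simp_rw [e]
    rw [this, Complex.real_smul, Real.fourier_eq', inv_inv, abs_of_pos (by positivity)]
    have hpi : (Real.pi : ℂ) ≠ 0 := by exact_mod_cast Real.pi_ne_zero
    push_cast
    rw [← mul_assoc, one_div, inv_mul_cancel₀ (by simp), one_mul]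
    refine integral_congr_ae (Eventually.of_forall fun x => ?_)
    simp [mul_comm]
  refine ⟨?_, ?_, ?_⟩
  · change MemLp (fun t => charFun ρ t) 2 volume
    rw [hscale]
    refine MemLp.comp_of_map (f := fun t : ℝ => (2 * Real.pi)⁻¹ * t) ?_ (by fun_prop)
    rw [hmap]
    exact hg₂.smul_measure ENNReal.ofReal_ne_top
  -- Truncating at `T` amounts to truncating `g` at `T / 2π`; by Plancherel the error is the `L²`
  -- norm of the discarded tail of `g`.
  · have hlim := (tendsto_eLpNorm_two_sub_indicator hg₂).comp
      (tendsto_id.atTop_div_const (show (0 : ℝ) < 2 * Real.pi by positivity))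
    refine hlim.congr' ?_
    filter_upwards [eventually_ge_atTop 0] with T hT
    set K := Ioc (-(T / (2 * Real.pi))) (T / (2 * Real.pi)) with hK
    have hgK₂ : MemLp (K.indicator g) 2 volume := hg₂.indicator measurableSet_Ioc
    have hgK₁ : Integrable (K.indicator g) := by
      rw [integrable_indicator_iff measurableSet_Ioc]
      have : IsFiniteMeasure (volume.restrict K) := ⟨by simp [hK]⟩
      exact (hg₂.restrict K).integrable (by norm_num)
    simp only [Function.comp_apply, id]
    rw [← eLpNorm_sub_fourier_eq hf₁ hf₂ hgK₁ hgK₂]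
    congr 1
    funext δ
    rw [hint, intervalIntegral.integral_of_le
      ((neg_nonpos.mpr (by positivity)).trans (by positivity : 0 ≤ T / (2 * Real.pi))),
      ← integral_indicator measurableSet_Ioc, Real.fourier_eq']
    congr 1
    refine integral_congr_ae (Eventually.of_forall fun x => ?_)
    by_cases hx : x ∈ K
    · simp only [← hK, Set.indicator_of_mem hx]
      simp [mul_comm]
    · simp only [← hK, Set.indicator_of_notMem hx]
      simp
  · intro hri
    have hg₁ : Integrable g := by
      have h := (hri.comp_mul_left' (g := charFun ρ) h2π)
      refine h.congr (Eventually.of_forall fun t => ?_)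
      simp only [hr]
      congr 1
      field_simp
    have h0 : eLpNorm (fun x => f x - 𝓕 g x) 2 volume = 0 := by
      rw [eLpNorm_sub_fourier_eq hf₁ hf₂ hg₁ hg₂]
      simp [hg_def]
    have hFg : AEStronglyMeasurable (fun x => f x - 𝓕 g x) volume := by
      have hcont : Continuous (𝓕 g : ℝ → ℂ) :=
        VectorFourier.fourierIntegral_continuous Real.continuous_fourierChar (by fun_prop) hg₁
      exact hf₁.1.sub hcont.aestronglyMeasurable
    rw [eLpNorm_eq_zero_iff hFg (by norm_num)] at h0
    filter_upwards [h0] with δ hδ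
    rw [hintegral]
    exact sub_eq_zero.mp hδ

end FourierInversion

/-! ### Regression functions of threshold-crossing models -/

section Regression

theorem measurable_charFun_kernel {𝒢 : Type*} [MeasurableSpace 𝒢] (κ : Kernel 𝒢 ℝ)
    [IsSFiniteKernel κ] (t : ℝ) : Measurable fun g => charFun (κ g) t := by
  simp_rw [charFun_apply_real]
  have : StronglyMeasurable fun q : 𝒢 × ℝ => Complex.exp (t * q.2 * Complex.I) :=
    Measurable.stronglyMeasurable (by fun_prop)
  exact (StronglyMeasurable.integral_kernel_prod_right' this).measurable

/-- Two versions continuous on the support and equal almost everywhere are equal there: their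
disagreement set is relatively open in the support, so it would have positive mass if it were
nonempty. -/
theorem regression_eqOn {T : Type*} [TopologicalSpace T] [MeasurableSpace T] [BorelSpace T]
    [HereditarilyLindelofSpace T]
    (Q : Measure (ℝ × ℝ × T)) [IsFiniteMeasure Q] {w : ℝ → ℝ → ℂ} {m : T → ℂ}
    (hw : Integrable (fun p : ℝ × ℝ × T => w p.1 p.2.1) Q) (hm : Continuous m)
    (hmi : Integrable (fun p : ℝ × ℝ × T => m p.2.2) Q)
    (h : ∀ B : Set T, MeasurableSet B →
      ∫ p in (fun p : ℝ × ℝ × T => p.2.2) ⁻¹' B, w p.1 p.2.1 ∂Q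
        = ∫ p in (fun p : ℝ × ℝ × T => p.2.2) ⁻¹' B, m p.2.2 ∂Q)
    {u : T} (hu : u ∈ (Q.map fun p => p.2.2).support) : regression Q w u = m u := by
  have hU : Measurable (fun p : ℝ × ℝ × T => p.2.2) := by fun_prop
  have hcond : (fun p : ℝ × ℝ × T => m p.2.2) =ᵐ[Q]
      Q[fun p => w p.1 p.2.1 |
        MeasurableSpace.comap (fun p : ℝ × ℝ × T => p.2.2) inferInstance] := by
    refine ae_eq_condExp_of_forall_setIntegral_eq hU.comap_le hw
      (fun s _ _ => hmi.integrableOn) ?_ ?_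
    · rintro s ⟨B, hB, rfl⟩ -
      exact (h B hB).symm
    · exact (hm.stronglyMeasurable.comp_measurable
        (comap_measurable _)).aestronglyMeasurable
  have hex : ∃ g : T → ℂ, ContinuousOn g (Q.map fun p => p.2.2).support ∧
      (fun p => g p.2.2) =ᵐ[Q] Q[fun p => w p.1 p.2.1 |
        MeasurableSpace.comap (fun p : ℝ × ℝ × T => p.2.2) inferInstance] :=
    ⟨m, hm.continuousOn, hcond⟩
  rw [regression, dif_pos hex]
  obtain ⟨hgc, hg⟩ := hex.choose_spec
  set g := hex.choose
  set S := (Q.map fun p => p.2.2).support with hS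
  by_contra hne
  have hev : ∀ᶠ v in 𝓝[S] u, g v ≠ m v :=
    ((hgc u hu).prodMk (hm.continuousWithinAt)).eventually
      ((isClosed_diagonal.isOpen_compl).mem_nhds (by simpa [mem_diagonal_iff] using hne))
  obtain ⟨N, hN, huN, hNS⟩ := mem_nhdsWithin.mp hev
  have hpos : 0 < (Q.map fun p => p.2.2) (N ∩ S) := by
    have h1 := (Measure.mem_support_iff_forall u).mp hu N (hN.mem_nhds huN)
    rwa [measure_inter_conull Measure.measure_compl_support]
  rw [Measure.map_apply hU (hN.measurableSet.inter Measure.isClosed_support.measurableSet)] at hpos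
  refine hpos.ne' (measure_mono_null ?_ (ae_iff.mp (hg.trans hcond.symm)))
  intro p hp
  exact hNS hp

/-- The regression function of a bounded transform of an outcome with kernel `κ` given the
unobservables, on a selection event `E` determined by the instruments and the unobservables. -/
theorem regression_selection {Ω T 𝒢 : Type*} [MeasurableSpace Ω] [MeasurableSpace 𝒢]
    [TopologicalSpace T] [MeasurableSpace T] [BorelSpace T] [HereditarilyLindelofSpace T]
    (P : Measure Ω) [IsProbabilityMeasure P]
    {Y D W : Ω → ℝ} {U : Ω → T} {G : Ω → 𝒢}
    (hY : Measurable Y) (hD : Measurable D) (hW : Measurable W) (hU : Measurable U)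
    (hG : Measurable G)
    {κ : Kernel 𝒢 ℝ} [IsMarkovKernel κ]
    (hind : P.map (fun ω => (U ω, G ω, W ω)) = (P.map U).prod (P.map fun ω => (G ω, W ω)))
    (hκ : P.map (fun ω => (G ω, W ω)) = P.map G ⊗ₘ κ)
    {E : Set (T × 𝒢)} (hE : MeasurableSet E) {w : ℝ → ℝ → ℂ}
    (hwm : Measurable fun p : ℝ × ℝ => w p.1 p.2) (t : ℝ) (c : ℂ)
    (hw : ∀ ω, w (Y ω) (D ω) =
      c * (Prod.mk (U ω) ⁻¹' E).indicator (fun _ => Complex.exp (t * W ω * Complex.I)) (G ω))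
    (hm : Continuous fun u => c * ∫ g, (Prod.mk u ⁻¹' E).indicator (fun g => charFun (κ g) t) g
      ∂(P.map G)) {u : T} (hu : u ∈ (P.map U).support) :
    regression (P.map fun ω => (Y ω, D ω, U ω)) w u =
      c * ∫ g, (Prod.mk u ⁻¹' E).indicator (fun g => charFun (κ g) t) g ∂(P.map G) := by
  have : IsProbabilityMeasure (P.map U) := Measure.isProbabilityMeasure_map hU.aemeasurable
  have : IsProbabilityMeasure (P.map G) := Measure.isProbabilityMeasure_map hG.aemeasurable
  have : IsProbabilityMeasure (P.map fun ω => (Y ω, D ω, U ω)) :=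
    Measure.isProbabilityMeasure_map (by fun_prop)
  have hmap : (P.map fun ω => (Y ω, D ω, U ω)).map (fun p => p.2.2) = P.map U := by
    rw [Measure.map_map (by fun_prop) (by fun_prop)]; rfl
  set F : T × 𝒢 × ℝ → ℂ := fun q =>
    c * (Prod.mk q.1 ⁻¹' E).indicator (fun _ => Complex.exp (t * q.2.2 * Complex.I)) q.2.1 with hF
  have hFm : Measurable F := by
    have : F = fun q => c * ((fun q : T × 𝒢 × ℝ => (q.1, q.2.1)) ⁻¹' E).indicator
        (fun q => Complex.exp (t * q.2.2 * Complex.I)) q := by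
      funext q
      by_cases hq : (q.1, q.2.1) ∈ E <;> simp [hF, hq]
    rw [this]
    exact ((Measurable.indicator (by fun_prop) (hE.preimage (by fun_prop)))).const_mul c
  have hexp : ∀ y : ℝ, ‖Complex.exp (t * y * Complex.I)‖ = 1 := fun y => by
    rw [← Complex.ofReal_mul]; exact Complex.norm_exp_ofReal_mul_I _
  have hFb : ∀ q, ‖F q‖ ≤ ‖c‖ := by
    intro q
    simp only [hF, norm_mul]
    refine mul_le_of_le_one_right (norm_nonneg _) ?_
    rw [norm_indicator_eq_indicator_norm]
    exact (indicator_le_self' (fun _ _ => norm_nonneg _) _).trans (hexp _).le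
  have hmb : ∀ u, ‖c * ∫ g, (Prod.mk u ⁻¹' E).indicator (fun g => charFun (κ g) t) g
      ∂(P.map G)‖ ≤ ‖c‖ := by
    intro u
    rw [norm_mul]
    refine mul_le_of_le_one_right (norm_nonneg _) ?_
    refine (norm_integral_le_of_norm_le_const (C := 1) (Eventually.of_forall fun g => ?_)).trans
      (by simp)
    rw [norm_indicator_eq_indicator_norm]
    exact (indicator_le_self' (fun _ _ => norm_nonneg _) _).trans (norm_charFun_le_one _)
  refine regression_eqOn (P.map fun ω => (Y ω, D ω, U ω)) ?_ hm ?_ ?_ (hmap.symm ▸ hu)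
  · refine Integrable.of_bound (C := ‖c‖) ?_ ?_
    · exact (hwm.comp (by fun_prop : Measurable fun p : ℝ × ℝ × T => (p.1, p.2.1))
        ).aestronglyMeasurable
    · have hwm' : Measurable fun p : ℝ × ℝ × T => w p.1 p.2.1 :=
        hwm.comp (by fun_prop : Measurable fun p : ℝ × ℝ × T => (p.1, p.2.1))
      rw [ae_map_iff (by fun_prop) (measurableSet_le hwm'.norm measurable_const)]
      refine Eventually.of_forall fun ω => ?_
      simp only [hw]
      exact hFb (U ω, G ω, W ω)
  · exact Integrable.of_bound (C := ‖c‖)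
      ((hm.measurable.comp (by fun_prop : Measurable fun p : ℝ × ℝ × T => p.2.2)
        ).aestronglyMeasurable) (Eventually.of_forall fun p => hmb _)
  · intro B hB
    have hB' : MeasurableSet ((fun p : ℝ × ℝ × T => p.2.2) ⁻¹' B) := hB.preimage (by fun_prop)
    rw [setIntegral_map hB' ?_ (by fun_prop), setIntegral_map hB' ?_ (by fun_prop)]
    rotate_left
    · exact (hm.measurable.comp (by fun_prop : Measurable fun p : ℝ × ℝ × T => p.2.2)
        ).aestronglyMeasurable
    · exact (hwm.comp (by fun_prop : Measurable fun p : ℝ × ℝ × T => (p.1, p.2.1))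
        ).aestronglyMeasurable
    have hpre : (fun ω => (Y ω, D ω, U ω)) ⁻¹' ((fun p : ℝ × ℝ × T => p.2.2) ⁻¹' B) = U ⁻¹' B := rfl
    rw [hpre]
    -- Independence turns the joint law into a product, so the instruments can be frozen by Fubini;
    -- integrating out the outcome given `G` then produces its characteristic function.
    calc ∫ ω in U ⁻¹' B, w (Y ω) (D ω) ∂P
        = ∫ ω in (fun ω => (U ω, G ω, W ω)) ⁻¹' (B ×ˢ univ), F (U ω, G ω, W ω) ∂P := by
          simp_rw [hw]
          congr 2
          ext ω; simp
      _ = ∫ q in B ×ˢ univ, F q ∂((P.map U).prod (P.map fun ω => (G ω, W ω))) := by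
          rw [← setIntegral_map (hB.prod MeasurableSet.univ) hFm.aestronglyMeasurable
            (by fun_prop), hind]
      _ = ∫ u in B, ∫ q, F (u, q) ∂(P.map fun ω => (G ω, W ω)) ∂(P.map U) := by
          have : IsProbabilityMeasure (P.map fun ω => (G ω, W ω)) :=
            Measure.isProbabilityMeasure_map (by fun_prop)
          rw [setIntegral_prod]
          · simp
          · exact (Integrable.of_bound hFm.aestronglyMeasurable ‖c‖
              (Eventually.of_forall hFb)).integrableOn
      _ = ∫ u in B, c * ∫ g, (Prod.mk u ⁻¹' E).indicator (fun g => charFun (κ g) t) g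
            ∂(P.map G) ∂(P.map U) := by
          congr 1
          funext u
          rw [hκ, Measure.integral_compProd, ← integral_const_mul]
          · refine integral_congr_ae (Eventually.of_forall fun g => ?_)
            simp only [hF]
            rw [integral_const_mul]
            by_cases hg : g ∈ Prod.mk u ⁻¹' E
            · simp [Set.indicator_of_mem hg, charFun_apply_real]
            · simp [Set.indicator_of_notMem hg]
          · exact Integrable.of_bound
              (hFm.comp (by fun_prop : Measurable fun q : 𝒢 × ℝ => (u, q))).aestronglyMeasurable
              ‖c‖ (Eventually.of_forall fun q => hFb _)
      _ = _ := by
          rw [setIntegral_map hB ?_ hU.aemeasurable]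
          exact hm.aestronglyMeasurable

end Regression

/-! ### Lebesgue differentiation of characteristic functions, simultaneously in the frequency -/

section UniformDifferentiation

theorem norm_exp_mul_I_sub_exp_mul_I_le (s t y : ℝ) :
    ‖Complex.exp (t * y * Complex.I) - Complex.exp (s * y * Complex.I)‖
      ≤ min 2 (|t - s| * |y|) := by
  refine le_min ?_ ?_
  · refine (norm_sub_le _ _).trans ?_
    rw [← Complex.ofReal_mul, ← Complex.ofReal_mul, Complex.norm_exp_ofReal_mul_I,
      Complex.norm_exp_ofReal_mul_I]
    norm_num
  · have h : Complex.exp (t * y * Complex.I) - Complex.exp (s * y * Complex.I)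
        = Complex.exp ((s * y : ℝ) * Complex.I)
          * (Complex.exp (Complex.I * ((t - s) * y : ℝ)) - 1) := by
      rw [mul_sub, ← Complex.exp_add, mul_one]
      push_cast
      ring_nf
    rw [h, norm_mul, Complex.norm_exp_ofReal_mul_I, one_mul, ← abs_mul, ← Real.norm_eq_abs]
    exact Real.norm_exp_I_mul_ofReal_sub_one_le

/-- A modulus of continuity uniform over pairs at distance at most `a`; the truncation at `2` makes
it finite without any moment condition. -/
theorem norm_charFun_sub_charFun_le {ρ : Measure ℝ} [IsProbabilityMeasure ρ] {s t a : ℝ}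
    (h : |t - s| ≤ a) :
    ‖charFun ρ t - charFun ρ s‖ ≤ ∫ y, min 2 (a * |y|) ∂ρ := by
  have hint : ∀ r : ℝ, Integrable (fun y : ℝ => Complex.exp (r * y * Complex.I)) ρ := fun r =>
    Integrable.of_bound (by fun_prop) 1 (Eventually.of_forall fun y => by
      rw [← Complex.ofReal_mul, Complex.norm_exp_ofReal_mul_I])
  rw [charFun_apply_real, charFun_apply_real, ← integral_sub (hint t) (hint s)]
  refine norm_integral_le_of_norm_le ?_ (Eventually.of_forall fun y => ?_)
  · refine Integrable.of_bound (by fun_prop) 2 (Eventually.of_forall fun y => ?_)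
    have ha : 0 ≤ a := (abs_nonneg _).trans h
    rw [Real.norm_of_nonneg (le_min (by norm_num) (by positivity))]
    exact min_le_left _ _
  · refine (norm_exp_mul_I_sub_exp_mul_I_le s t y).trans ?_
    gcongr

theorem tendsto_integral_min_two (ρ : Measure ℝ) [IsProbabilityMeasure ρ] :
    Tendsto (fun n : ℕ => ∫ y, min 2 ((1 / (n + 1 : ℝ)) * |y|) ∂ρ) atTop (𝓝 0) := by
  have : Tendsto (fun n : ℕ => ∫ y, min 2 ((1 / (n + 1 : ℝ)) * |y|) ∂ρ) atTop
      (𝓝 (∫ _, (0 : ℝ) ∂ρ)) := by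
    refine tendsto_integral_of_dominated_convergence (fun _ => 2) (fun n => by fun_prop)
      (integrable_const _) (fun n => Eventually.of_forall fun y => ?_)
      (Eventually.of_forall fun y => ?_)
    · rw [Real.norm_of_nonneg (le_min (by norm_num) (by positivity))]
      exact min_le_left _ _
    · have h1 : Tendsto (fun n : ℕ => (1 / (n + 1 : ℝ)) * |y|) atTop (𝓝 (0 * |y|)) :=
        tendsto_one_div_add_atTop_nhds_zero_nat.mul_const _
      have := (tendsto_const_nhds (x := (2 : ℝ))).min h1
      simpa using this
  simpa using this

theorem integrable_charFun_mul {α : Type*} [MeasurableSpace α] {m : Measure α}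
    (κ : Kernel α ℝ) [IsMarkovKernel κ] {f : α → ℝ} (hf : Integrable f m) (t : ℝ) :
    Integrable (fun y => charFun (κ y) t * (f y : ℂ)) m :=
  hf.ofReal.bdd_mul (c := 1) (measurable_charFun_kernel κ t).aestronglyMeasurable
    (Eventually.of_forall fun _ => norm_charFun_le_one _)

/-- For almost every `x`, the averages of `y ↦ charFun (κ y) t * f y` along a Vitali family converge
to the value at `x`, for all `t`. -/
theorem ae_forall_tendsto_average_charFun {α : Type*} [PseudoMetricSpace α] [MeasurableSpace α]
    [SecondCountableTopology α] [BorelSpace α] {m : Measure α} [IsLocallyFiniteMeasure m]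
    (v : VitaliFamily m) (κ : Kernel α ℝ) [IsMarkovKernel κ] {f : α → ℝ} (hf₀ : ∀ x, 0 ≤ f x)
    (hf : Integrable f m) :
    ∀ᵐ x ∂m, ∀ t : ℝ, Tendsto (fun a => ⨍ y in a, charFun (κ y) t * (f y : ℂ) ∂m)
      (v.filterAt x) (𝓝 (charFun (κ x) t * (f x : ℂ))) := by
  -- These countably many integrable functions bound the oscillation in `t`. Differentiating them
  -- together with the rational frequencies leaves a single null set for all `t`.
  set h : ℕ → α → ℝ := fun n x => (∫ y, min 2 ((1 / (n + 1 : ℝ)) * |y|) ∂(κ x)) * f x with hh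
  have hbd : ∀ (n : ℕ) (y : ℝ), 0 ≤ min 2 ((1 / (n + 1 : ℝ)) * |y|) := fun n y =>
    le_min (by norm_num) (by positivity)
  have hhi : ∀ n, Integrable (h n) m := by
    intro n
    refine hf.bdd_mul (c := 2) ?_ (Eventually.of_forall fun x => ?_)
    · have : StronglyMeasurable fun q : α × ℝ => min 2 ((1 / (n + 1 : ℝ)) * |q.2|) :=
        Measurable.stronglyMeasurable (by fun_prop)
      exact (StronglyMeasurable.integral_kernel_prod_right' this).aestronglyMeasurable
    · refine (norm_integral_le_of_norm_le_const (C := 2) (Eventually.of_forall fun y => ?_)).trans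
        (by simp)
      rw [Real.norm_of_nonneg (hbd n y)]
      exact min_le_left _ _
  have hFi := fun t => integrable_charFun_mul (m := m) κ hf t
  have hle : ∀ (n : ℕ) (s t : ℝ), |t - s| ≤ 1 / (n + 1 : ℝ) → ∀ x,
      ‖charFun (κ x) t * (f x : ℂ) - charFun (κ x) s * (f x : ℂ)‖ ≤ h n x := by
    intro n s t hst x
    rw [← sub_mul, norm_mul, Complex.norm_real, Real.norm_of_nonneg (hf₀ x)]
    exact mul_le_mul_of_nonneg_right (norm_charFun_sub_charFun_le hst) (hf₀ x)
  have h1 : ∀ᵐ x ∂m, ∀ q : ℚ, Tendsto (fun a => ⨍ y in a, charFun (κ y) q * (f y : ℂ) ∂m)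
      (v.filterAt x) (𝓝 (charFun (κ x) q * (f x : ℂ))) :=
    ae_all_iff.mpr fun q => v.ae_tendsto_average (hFi q).locallyIntegrable
  have h2 : ∀ᵐ x ∂m, ∀ n : ℕ, Tendsto (fun a => ⨍ y in a, h n y ∂m)
      (v.filterAt x) (𝓝 (h n x)) :=
    ae_all_iff.mpr fun n => v.ae_tendsto_average (hhi n).locallyIntegrable
  filter_upwards [h1, h2] with x hx1 hx2 t
  rw [Metric.tendsto_nhds]
  intro ε hε
  have hlim : Tendsto (fun n => h n x) atTop (𝓝 0) := by
    simpa [hh] using (tendsto_integral_min_two (κ x)).mul_const (f x)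
  -- First fix a scale at which the oscillation at `x` is below `ε / 4`, then take a rational
  -- frequency within that scale. Each of the three errors below is then less than `ε / 4`.
  obtain ⟨n, hn⟩ := (hlim.eventually (gt_mem_nhds (show 0 < ε / 4 by positivity))).exists
  obtain ⟨q, hq⟩ := exists_rat_near t (show (0 : ℝ) < 1 / (n + 1 : ℝ) by positivity)
  filter_upwards [(Metric.tendsto_nhds.mp (hx1 q)) (ε / 4) (by positivity),
    (hx2 n).eventually (gt_mem_nhds hn)] with a ha1 ha2
  have hd1 : dist (⨍ y in a, charFun (κ y) t * (f y : ℂ) ∂m)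
      (⨍ y in a, charFun (κ y) q * (f y : ℂ) ∂m) ≤ ⨍ y in a, h n y ∂m := by
    rw [dist_eq_norm, setAverage_eq, setAverage_eq, setAverage_eq, ← smul_sub,
      ← integral_sub (hFi t).integrableOn (hFi q).integrableOn, norm_smul, smul_eq_mul,
      Real.norm_of_nonneg (by positivity)]
    refine mul_le_mul_of_nonneg_left ?_ (by positivity)
    exact norm_integral_le_of_norm_le (hhi n).integrableOn
      (Eventually.of_forall fun y => hle n q t hq.le y)
  have hd2 : dist (charFun (κ x) q * (f x : ℂ)) (charFun (κ x) t * (f x : ℂ)) ≤ h n x := by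
    rw [dist_comm, dist_eq_norm]
    exact hle n q t hq.le x
  calc dist (⨍ y in a, charFun (κ y) t * (f y : ℂ) ∂m) (charFun (κ x) t * (f x : ℂ))
      ≤ dist (⨍ y in a, charFun (κ y) t * (f y : ℂ) ∂m)
          (⨍ y in a, charFun (κ y) q * (f y : ℂ) ∂m)
        + dist (⨍ y in a, charFun (κ y) q * (f y : ℂ) ∂m) (charFun (κ x) q * (f x : ℂ))
        + dist (charFun (κ x) q * (f x : ℂ)) (charFun (κ x) t * (f x : ℂ)) :=
        dist_triangle4 _ _ _ _
    _ < ε := by linarith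

/-- If the averages of `f` over intervals at `x` converge to `f x`, the integral function of `f`
has derivative `f x` at `x`. -/
theorem hasDerivAt_integral_Iio_of_tendsto_average {f : ℝ → ℂ} (hf : Integrable f) {x : ℝ}
    (hx : Tendsto (fun a => ⨍ y in a, f y)
      ((IsUnifLocDoublingMeasure.vitaliFamily (volume : Measure ℝ) 1).filterAt x) (𝓝 (f x))) :
    HasDerivAt (fun v => ∫ y in Iio v, f y) (f x) x := by
  have hg (x y : ℝ) : IntervalIntegrable f volume x y := hf.intervalIntegrable
  have h {a b : ℝ} : ∫ (t : ℝ) in Ioc a b, f t = ∫ (t : ℝ) in Icc a b, f t :=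
    integral_Icc_eq_integral_Ioc.symm
  have hd : HasDerivAt (fun v => ∫ t in x..v, f t) (f x) x := by
    -- One-sided slopes at `x` are averages over intervals with endpoint `x`, and these intervals
    -- converge to `x` in the Vitali family.
    rw [hasDerivAt_iff_tendsto_slope_left_right]
    constructor
    · refine Filter.tendsto_congr' ?_ |>.mpr (hx.comp x.tendsto_Icc_vitaliFamily_left)
      filter_upwards [self_mem_nhdsWithin] with y hy
      replace hy : y ≤ x := hy.le
      suffices -((y - x)⁻¹ • ∫ (t : ℝ) in Icc y x, f t) = (x - y)⁻¹ • ∫ (t : ℝ) in Icc y x, f t by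
        simpa [slope, average, intervalIntegral.integral_of_ge, hy, h]
      rw [← neg_smul, neg_inv, neg_sub]
    · refine Filter.tendsto_congr' ?_ |>.mpr (hx.comp x.tendsto_Icc_vitaliFamily_right)
      filter_upwards [self_mem_nhdsWithin] with y hy
      replace hy : x ≤ y := hy.le
      simp [slope, average, intervalIntegral.integral_of_le, hy, h]
  have heq : (fun v => ∫ y in Iio v, f y) = fun v => (∫ t in x..v, f t) + ∫ y in Iio x, f y := by
    funext v
    rw [← integral_Iic_eq_integral_Iio, ← integral_Iic_eq_integral_Iio,
      ← intervalIntegral.integral_Iic_sub_Iic hf.integrableOn hf.integrableOn, sub_add_cancel]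
  rw [heq]
  exact hd.add_const _

end UniformDifferentiation

/-- Dominated convergence: wherever `h u a ≠ 0`, the sign of `h · a` is constant near `u`, so the
indicator is too. -/
theorem continuous_setIntegral_of_threshold {α T E : Type*} [MeasurableSpace α]
    [TopologicalSpace T] [FirstCountableTopology T] [NormedAddCommGroup E] [NormedSpace ℝ E]
    {ν : Measure α} {φ : α → E} (hφ : Integrable φ ν) {h : T → α → ℝ}
    (hm : ∀ u, Measurable (h u)) (hc : ∀ a, Continuous fun u => h u a)
    (h0 : ∀ u, ∀ᵐ a ∂ν, h u a ≠ 0) :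
    Continuous fun u => ∫ a in {a | 0 < h u a}, φ a ∂ν := by
  have hs : ∀ u, MeasurableSet {a | 0 < h u a} := fun u => measurableSet_lt measurable_const (hm u)
  simp_rw [← fun u => integral_indicator (μ := ν) (f := φ) (hs u)]
  refine continuous_iff_continuousAt.mpr fun u => ?_
  refine continuousAt_of_dominated (bound := fun a => ‖φ a‖)
    (Eventually.of_forall fun v => hφ.1.indicator (hs v))
    (Eventually.of_forall fun v => Eventually.of_forall fun a => norm_indicator_le_norm_self _ _)
    hφ.norm ?_
  filter_upwards [h0 u] with a ha
  rcases ha.lt_or_gt with hlt | hgt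
  · refine (continuousAt_const (y := (0 : E))).congr ?_
    filter_upwards [(hc a).continuousAt.eventually (gt_mem_nhds hlt)] with v hv
    rw [Set.indicator_of_notMem (s := {a | 0 < h v a}) (fun hh => lt_asymm hv hh)]
  · refine (continuousAt_const (y := φ a)).congr ?_
    filter_upwards [(hc a).continuousAt.eventually (lt_mem_nhds hgt)] with v hv
    rw [Set.indicator_of_mem (s := {a | 0 < h v a}) hv]

/-! ### Regressions of the treated and untreated outcomes -/

section Selection

variable {Ω T 𝒢 : Type*} [MeasurableSpace Ω] [MeasurableSpace 𝒢]
  [TopologicalSpace T] [MeasurableSpace T] [BorelSpace T] [HereditarilyLindelofSpace T]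
  {P : Measure Ω} [IsProbabilityMeasure P]
  {Y₀ Y₁ Y D : Ω → ℝ} {U : Ω → T} {G : Ω → 𝒢} {κ : Kernel 𝒢 ℝ} [IsMarkovKernel κ]
  {A : Set (T × 𝒢)}

/-- The weight vanishes off the selection event, where `D = 0`, and equals `e^{itY₁}` on it; hence
only the joint law of `G` and `Y₁` matters. -/
theorem regression_treatedWeight
    (hY : Measurable Y) (hD : Measurable D) (hY₁ : Measurable Y₁) (hU : Measurable U)
    (hG : Measurable G) (hA : MeasurableSet A)
    (hDA : ∀ ω, D ω = A.indicator 1 (U ω, G ω)) (hYD : ∀ ω, Y ω = Y₀ ω + (Y₁ ω - Y₀ ω) * D ω)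
    (hind : P.map (fun ω => (U ω, G ω, Y₁ ω)) = (P.map U).prod (P.map fun ω => (G ω, Y₁ ω)))
    (hκ : P.map (fun ω => (G ω, Y₁ ω)) = P.map G ⊗ₘ κ) {t : ℝ}
    (hm : Continuous fun u => ∫ g in Prod.mk u ⁻¹' A, charFun (κ g) t ∂(P.map G))
    {u : T} (hu : u ∈ (P.map U).support) :
    regression (P.map fun ω => (Y ω, D ω, U ω)) (treatedWeight t) u =
      ∫ g in Prod.mk u ⁻¹' A, charFun (κ g) t ∂(P.map G) := by
  have hs : ∀ u, MeasurableSet (Prod.mk u ⁻¹' A) := fun u => hA.preimage (by fun_prop)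
  simp_rw [← fun u => integral_indicator (μ := P.map G) (f := fun g => charFun (κ g) t)
    (hs u)] at hm ⊢
  rw [regression_selection P hY hD hY₁ hU hG hind hκ hA ?_ t 1 ?_ (by simpa using hm) hu, one_mul]
  · unfold treatedWeight; fun_prop
  · intro ω
    have h1 := hYD ω
    have h2 := hDA ω
    by_cases h : (U ω, G ω) ∈ A
    · have h' : G ω ∈ Prod.mk (U ω) ⁻¹' A := h
      rw [Set.indicator_of_mem h, Pi.one_apply] at h2
      rw [Set.indicator_of_mem h', treatedWeight, h1, h2]
      simp [mul_comm, mul_left_comm]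
    · have h' : G ω ∉ Prod.mk (U ω) ⁻¹' A := h
      rw [Set.indicator_of_notMem h] at h2
      rw [Set.indicator_of_notMem h', treatedWeight, h2]
      simp

/-- The weight is `-e^{itY₀}` on the complement of the selection event and zero elsewhere. Minus an
integral over the complement is the integral over the event minus the full one, and the full one
does not depend on `u`. -/
theorem regression_untreatedWeight
    (hY : Measurable Y) (hD : Measurable D) (hY₀ : Measurable Y₀) (hU : Measurable U)
    (hG : Measurable G) (hA : MeasurableSet A)
    (hDA : ∀ ω, D ω = A.indicator 1 (U ω, G ω)) (hYD : ∀ ω, Y ω = Y₀ ω + (Y₁ ω - Y₀ ω) * D ω)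
    (hind : P.map (fun ω => (U ω, G ω, Y₀ ω)) = (P.map U).prod (P.map fun ω => (G ω, Y₀ ω)))
    (hκ : P.map (fun ω => (G ω, Y₀ ω)) = P.map G ⊗ₘ κ) {t : ℝ}
    (hm : Continuous fun u => ∫ g in Prod.mk u ⁻¹' A, charFun (κ g) t ∂(P.map G))
    {u : T} (hu : u ∈ (P.map U).support) :
    regression (P.map fun ω => (Y ω, D ω, U ω)) (untreatedWeight t) u =
      (∫ g in Prod.mk u ⁻¹' A, charFun (κ g) t ∂(P.map G))
        - ∫ g, charFun (κ g) t ∂(P.map G) := by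
  have : IsProbabilityMeasure (P.map G) := Measure.isProbabilityMeasure_map hG.aemeasurable
  have hs : ∀ u, MeasurableSet (Prod.mk u ⁻¹' A) := fun u => hA.preimage (by fun_prop)
  have hφ : Integrable (fun g => charFun (κ g) t) (P.map G) :=
    Integrable.of_bound (measurable_charFun_kernel κ t).aestronglyMeasurable 1
      (Eventually.of_forall fun _ => norm_charFun_le_one _)
  have heq : ∀ u, (-1 : ℂ) * ∫ g, (Prod.mk u ⁻¹' Aᶜ).indicator (fun g => charFun (κ g) t) g
      ∂(P.map G) = (∫ g in Prod.mk u ⁻¹' A, charFun (κ g) t ∂(P.map G))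
        - ∫ g, charFun (κ g) t ∂(P.map G) := by
    intro u
    rw [preimage_compl, integral_indicator (hs u).compl, ← integral_add_compl (hs u) hφ]
    ring
  rw [← heq]
  refine regression_selection P hY hD hY₀ hU hG hind hκ hA.compl ?_ t (-1) ?_ ?_ hu
  · unfold untreatedWeight; fun_prop
  · intro ω
    have h1 := hYD ω
    have h2 := hDA ω
    by_cases h : (U ω, G ω) ∈ A
    · have h' : G ω ∉ Prod.mk (U ω) ⁻¹' Aᶜ := fun hh => hh h
      rw [Set.indicator_of_mem h, Pi.one_apply] at h2
      rw [Set.indicator_of_notMem h', untreatedWeight, h2]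
      simp
    · have h' : G ω ∈ Prod.mk (U ω) ⁻¹' Aᶜ := h
      rw [Set.indicator_of_notMem h] at h2
      rw [Set.indicator_of_mem h', untreatedWeight, h1, h2]
      simp [mul_comm, mul_left_comm]
  · simp_rw [heq]
    exact hm.sub continuous_const

end Selection

/-! ### A scalar unobservable -/

section Scalar

/-- A law without atoms has no isolated point in its support, so derivatives within the support are
unique. -/
theorem accPt_support_of_absolutelyContinuous {ρ : Measure ℝ} (hρ : ρ ≪ volume) {x : ℝ}
    (hx : x ∈ ρ.support) : AccPt x (𝓟 ρ.support) := by
  rw [accPt_iff_nhds]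
  intro N hN
  have h1 : 0 < ρ (N ∩ ρ.support ∩ {x}ᶜ) := by
    rw [measure_inter_conull (by rw [compl_compl]; exact hρ (by simp)),
      measure_inter_conull Measure.measure_compl_support]
    exact (Measure.mem_support_iff_forall x).mp hx N hN
  obtain ⟨y, hy, hyx⟩ := nonempty_of_measure_ne_zero h1.ne'
  exact ⟨y, hy, hyx⟩

theorem dvRegression_eq_of_hasDerivAt {Q : Measure (ℝ × ℝ × ℝ)} {w : ℝ → ℝ → ℂ} {m : ℝ → ℂ}
    {m' : ℂ} {v : ℝ} (hQ : Q.map (fun p => p.2.2) ≪ volume)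
    (hreg : ∀ u ∈ (Q.map fun p => p.2.2).support, regression Q w u = m u)
    (hv : v ∈ (Q.map fun p => p.2.2).support) (hm : HasDerivAt m m' v) :
    dvRegression Q w v = m' := by
  simp only [dvRegression]
  rw [if_pos hv]
  have hu : UniqueDiffWithinAt ℝ (Q.map fun p => p.2.2).support v :=
    uniqueDiffWithinAt_iff_accPt.mpr (accPt_support_of_absolutelyContinuous hQ hv)
  exact ((hm.hasDerivWithinAt).congr_of_mem hreg hv).derivWithin hu

theorem setIntegral_charFun_eq {α : Type*} [MeasurableSpace α] {ν m : Measure α}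
    [SigmaFinite ν] [SigmaFinite m] (hν : ν ≪ m) (κ : Kernel α ℝ) (t : ℝ) {s : Set α}
    (hs : MeasurableSet s) :
    ∫ g in s, charFun (κ g) t ∂ν
      = ∫ g in s, charFun (κ g) t * ((ν.rnDeriv m g).toReal : ℂ) ∂m := by
  rw [← setIntegral_rnDeriv_smul hν hs]
  refine setIntegral_congr_fun hs fun g _ => ?_
  rw [Complex.real_smul, mul_comm]

/-- On the support of `V` both regressions are, up to a constant, integral functions of `φ_j f` over
`θ < v`, so their derivatives come from Lebesgue differentiation. This is pointwise, which is why
only `θ` in the support of `V` is required. -/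
theorem ae_dvRegression_eq {Ω : Type*} [MeasurableSpace Ω] {P : Measure Ω}
    [IsProbabilityMeasure P] {Y₀ Y₁ Y D V Θ : Ω → ℝ} {κ₀ κ₁ : Kernel ℝ ℝ} [IsMarkovKernel κ₀]
    [IsMarkovKernel κ₁] (hY₀ : Measurable Y₀) (hY₁ : Measurable Y₁) (hV : Measurable V)
    (hΘ : Measurable Θ) (hY : Measurable Y) (hD : Measurable D)
    (hDA : ∀ ω, D ω = {ω' | V ω' - Θ ω' > 0}.indicator 1 ω)
    (hYD : ∀ ω, Y ω = Y₀ ω + (Y₁ ω - Y₀ ω) * D ω)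
    (hVac : P.map V ≪ volume) (hΘac : P.map Θ ≪ volume)
    (hind₀ : P.map (fun ω => (V ω, Θ ω, Y₀ ω)) = (P.map V).prod (P.map fun ω => (Θ ω, Y₀ ω)))
    (hind₁ : P.map (fun ω => (V ω, Θ ω, Y₁ ω)) = (P.map V).prod (P.map fun ω => (Θ ω, Y₁ ω)))
    (hκ₀ : P.map (fun ω => (Θ ω, Y₀ ω)) = P.map Θ ⊗ₘ κ₀)
    (hκ₁ : P.map (fun ω => (Θ ω, Y₁ ω)) = P.map Θ ⊗ₘ κ₁) :
    ∀ᵐ θ ∂(P.map Θ), θ ∈ (P.map V).support → ∀ t : ℝ,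
      dvRegression (P.map fun ω => (Y ω, D ω, V ω)) (treatedWeight t) θ
        = charFun (κ₁ θ) t * (((P.map Θ).rnDeriv volume θ).toReal : ℂ) ∧
      dvRegression (P.map fun ω => (Y ω, D ω, V ω)) (untreatedWeight t) θ
        = charFun (κ₀ θ) t * (((P.map Θ).rnDeriv volume θ).toReal : ℂ) := by
  have : IsProbabilityMeasure (P.map Θ) := Measure.isProbabilityMeasure_map hΘ.aemeasurable
  set f : ℝ → ℝ := fun θ => ((P.map Θ).rnDeriv volume θ).toReal with hf
  have hfi : Integrable f := Measure.integrable_toReal_rnDeriv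
  set A : Set (ℝ × ℝ) := {p | p.2 < p.1} with hA
  have hAm : MeasurableSet A := measurableSet_lt measurable_snd measurable_fst
  have hDA' : ∀ ω, D ω = A.indicator 1 (V ω, Θ ω) := by
    intro ω
    rw [hDA ω]
    by_cases h : Θ ω < V ω <;> simp [hA, h]
  have hpre : ∀ v : ℝ, Prod.mk v ⁻¹' A = Iio v := fun v => rfl
  have hm : ∀ (κ : Kernel ℝ ℝ) (t : ℝ) (v : ℝ),
      ∫ g in Prod.mk v ⁻¹' A, charFun (κ g) t ∂(P.map Θ)
        = ∫ g in Iio v, charFun (κ g) t * (f g : ℂ) := fun κ t v => by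
    rw [hpre, setIntegral_charFun_eq hΘac κ t measurableSet_Iio]
  have hcont : ∀ (κ : Kernel ℝ ℝ) [IsMarkovKernel κ] (t : ℝ),
      Continuous fun v => ∫ g in Prod.mk v ⁻¹' A, charFun (κ g) t ∂(P.map Θ) := by
    intro κ _ t
    have hs : ∀ v : ℝ, Iio v = {g | 0 < v - g} := fun v => by ext g; simp
    simp_rw [hm, hs]
    refine continuous_setIntegral_of_threshold (integrable_charFun_mul κ hfi t) (by fun_prop)
      (by fun_prop) fun u => ?_
    rw [ae_iff]
    simp only [ne_eq, not_not, sub_eq_zero]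
    exact measure_mono_null (t := {u}) (fun x hx => hx.symm) (by simp)
  have hQV : (P.map fun ω => (Y ω, D ω, V ω)).map (fun p => p.2.2) = P.map V := by
    rw [Measure.map_map (by fun_prop) (by fun_prop)]; rfl
  have hder := fun (κ : Kernel ℝ ℝ) [IsMarkovKernel κ] =>
    ae_forall_tendsto_average_charFun
      (IsUnifLocDoublingMeasure.vitaliFamily (volume : Measure ℝ) 1) κ
      (fun _ => ENNReal.toReal_nonneg) hfi
  -- Differentiation holds off a Lebesgue-null set, which is also null for the law of `Θ`.
  filter_upwards [hΘac.ae_le (hder κ₀), hΘac.ae_le (hder κ₁)] with θ h₀ h₁ hθ t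
  have hd : ∀ (κ : Kernel ℝ ℝ) [IsMarkovKernel κ],
      Tendsto (fun a => ⨍ y in a, charFun (κ y) t * (f y : ℂ))
        ((IsUnifLocDoublingMeasure.vitaliFamily (volume : Measure ℝ) 1).filterAt θ)
        (𝓝 (charFun (κ θ) t * (f θ : ℂ))) →
      HasDerivAt (fun v => ∫ g in Prod.mk v ⁻¹' A, charFun (κ g) t ∂(P.map Θ))
        (charFun (κ θ) t * (f θ : ℂ)) θ := by
    intro κ _ h
    simp_rw [hm]
    exact hasDerivAt_integral_Iio_of_tendsto_average (integrable_charFun_mul κ hfi t) h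
  constructor
  · refine dvRegression_eq_of_hasDerivAt (hQV ▸ hVac) (fun u hu => ?_) (hQV ▸ hθ) (hd κ₁ (h₁ t))
    exact regression_treatedWeight hY hD hY₁ hV hΘ hAm hDA' hYD hind₁ hκ₁ (hcont κ₁ t) (hQV ▸ hu)
  · refine dvRegression_eq_of_hasDerivAt (hQV ▸ hVac) (fun u hu => ?_) (hQV ▸ hθ)
      ((hd κ₀ (h₀ t)).sub_const (∫ g, charFun (κ₀ g) t ∂(P.map Θ)))
    exact regression_untreatedWeight hY hD hY₀ hV hΘ hAm hDA' hYD hind₀ hκ₀ (hcont κ₀ t) (hQV ▸ hu)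

end Scalar

/-! ### The Radon transform -/

section RadonTransform

open FourierTransform SchwartzMap

/-! ### Fubini along parallel hyperplanes -/

section Hyperplanes

variable {E : Type*} [NormedAddCommGroup E] [InnerProductSpace ℝ E] [FiniteDimensional ℝ E]
  [MeasurableSpace E] [BorelSpace E]

/-- The orthogonal splitting into the line of `s` and its complement is an isometry, and a unit
vector identifies that line isometrically with `ℝ`. -/
theorem measurePreserving_smul_add_orthogonal {s : E} (hs : ‖s‖ = 1) :
    MeasurePreserving (fun p : ℝ × (Submodule.span ℝ {s})ᗮ => p.1 • s + (p.2 : E))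
      ((volume : Measure ℝ).prod volume) volume := by
  have h1 : MeasurePreserving (Prod.map (LinearIsometryEquiv.toSpanUnitSingleton (𝕜 := ℝ) s hs)
      (id : (Submodule.span ℝ {s})ᗮ → (Submodule.span ℝ {s})ᗮ))
      ((volume : Measure ℝ).prod volume) (volume.prod volume) :=
    (LinearIsometryEquiv.measurePreserving _).prod (MeasurePreserving.id _)
  have h2 := WithLp.volume_preserving_toLp (Submodule.span ℝ {s}) (Submodule.span ℝ {s})ᗮ
  have h3 := (Submodule.span ℝ {s}).orthogonalDecomposition.symm.measurePreserving
  refine (congrArg (fun F => MeasurePreserving F ((volume : Measure ℝ).prod volume) volume) ?_).mp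
    (h3.comp (h2.comp h1))
  funext p
  simp

theorem integrable_prod_smul_add_orthogonal {s : E} (hs : ‖s‖ = 1) {f : E → ℂ}
    (hf : Integrable f) :
    Integrable (fun p : ℝ × (Submodule.span ℝ {s})ᗮ => f (p.1 • s + (p.2 : E)))
      ((volume : Measure ℝ).prod volume) :=
  (measurePreserving_smul_add_orthogonal hs).integrable_comp_of_integrable hf

theorem inner_smul_add_orthogonal {E : Type*} [NormedAddCommGroup E] [InnerProductSpace ℝ E]
    {s : E} (hs : ‖s‖ = 1) (u : ℝ) (y : (Submodule.span ℝ {s})ᗮ) :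
    inner ℝ s (u • s + (y : E)) = u := by
  rw [inner_add_right, inner_smul_right, real_inner_self_eq_norm_sq, hs,
    Submodule.mem_orthogonal_singleton_iff_inner_right.mp y.2]
  simp

/-- Used with an indicator of a half-line for half-space integrals, and with a complex exponential
for the Fourier slice theorem. -/
theorem integral_comp_inner_mul {s : E} (hs : ‖s‖ = 1) {f : E → ℂ} (hf : Integrable f)
    {g : ℝ → ℂ} (hg : Measurable g) {C : ℝ} (hC : ∀ u, ‖g u‖ ≤ C) :
    ∫ x, g (inner ℝ s x) * f x
      = ∫ u : ℝ, g u * ∫ y : (Submodule.span ℝ {s})ᗮ, f (u • s + (y : E)) := by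
  have hmp := measurePreserving_smul_add_orthogonal hs
  have hgm : Measurable fun x : E => g (inner ℝ s x) := hg.comp (by fun_prop)
  have hgf : Integrable (fun x => g (inner ℝ s x) * f x) :=
    hf.bdd_mul hgm.aestronglyMeasurable (Eventually.of_forall fun x => hC _)
  rw [← hmp.map_eq, integral_map hmp.measurable.aemeasurable (by rw [hmp.map_eq]; exact hgf.1),
    integral_prod]
  · simp_rw [inner_smul_add_orthogonal hs, integral_const_mul]
  · exact hmp.integrable_comp_of_integrable hgf

end Hyperplanes

variable {d : ℕ}

theorem radon_eq (f : Eu (d + 1) → ℂ) (s : Sph d) (u : ℝ) :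
    radon f s u = ∫ y : (Submodule.span ℝ {(s : Eu (d + 1))})ᗮ, f (u • (s : Eu (d + 1)) + y) := by
  rw [radon, OrthonormalBasis.addHaar_eq_volume]

theorem norm_coe_sph (s : Sph d) : ‖(s : Eu (d + 1))‖ = 1 := norm_eq_of_mem_sphere s

theorem integrable_radon {f : Eu (d + 1) → ℂ} (hf : Integrable f) (s : Sph d) :
    Integrable (radon f s) := by
  have := (integrable_prod_smul_add_orthogonal (norm_coe_sph s) hf).integral_prod_left
  exact this.congr (Eventually.of_forall fun u => (radon_eq f s u).symm)

/-- Integrating over a half-space is integrating the Radon transform over a half-line. -/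
theorem setIntegral_halfSpace_eq {f : Eu (d + 1) → ℂ} (hf : Integrable f) (s : Sph d) (v : ℝ) :
    ∫ x in {x | inner ℝ (s : Eu (d + 1)) x < v}, f x = ∫ u in Iio v, radon f s u := by
  have hm : MeasurableSet {x : Eu (d + 1) | inner ℝ (s : Eu (d + 1)) x < v} :=
    measurableSet_lt (by fun_prop) measurable_const
  have h := integral_comp_inner_mul (norm_coe_sph s) hf
    (g := (Iio v).indicator fun _ => 1) (measurable_const.indicator measurableSet_Iio) (C := 1)
    (fun u => (norm_indicator_le_norm_self _ _).trans (by simp))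
  rw [← integral_indicator hm, ← integral_indicator measurableSet_Iio]
  calc _ = _ := integral_congr_ae (Eventually.of_forall fun x => by
        simp only [Set.indicator_apply, mem_ofPred_eq, mem_Iio]; split_ifs <;> simp)
    _ = _ := h
    _ = _ := integral_congr_ae (Eventually.of_forall fun u => by
        simp only [Set.indicator_apply, mem_Iio, radon_eq]; split_ifs <;> simp)

/-- The Fourier slice theorem. -/
theorem fourier_smul_eq_integral_radon {f : Eu (d + 1) → ℂ} (hf : Integrable f) (s : Sph d)
    (σ : ℝ) : 𝓕 f (σ • (s : Eu (d + 1)))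
      = ∫ u : ℝ, Complex.exp (↑(-2 * Real.pi * (u * σ)) * Complex.I) * radon f s u := by
  have h := integral_comp_inner_mul (norm_coe_sph s) hf
    (g := fun u : ℝ => Complex.exp (↑(-2 * Real.pi * (u * σ)) * Complex.I)) (by fun_prop) (C := 1)
    (fun u => (Complex.norm_exp_ofReal_mul_I _).le)
  simp_rw [radon_eq]
  rw [← h, Real.fourier_eq']
  refine integral_congr_ae (Eventually.of_forall fun x => ?_)
  simp only [smul_eq_mul, inner_smul_right]
  rw [real_inner_comm, mul_comm σ]

/-- The Fourier transform is injective on `L¹`. -/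
theorem ae_eq_of_fourier_eq {E : Type*} [NormedAddCommGroup E] [InnerProductSpace ℝ E]
    [FiniteDimensional ℝ E] [MeasurableSpace E] [BorelSpace E] {f f' : E → ℂ}
    (hf : Integrable f) (hf' : Integrable f') (h : ∀ ξ, 𝓕 f ξ = 𝓕 f' ξ) : f =ᵐ[volume] f' := by
  refine ae_eq_of_integral_contDiff_smul_eq hf.locallyIntegrable hf'.locallyIntegrable ?_
  intro g hg hgc
  have hg₁ : HasCompactSupport (Complex.ofRealCLM ∘ g) := hgc.comp_left rfl
  have hg₂ : ContDiff ℝ (⊤ : ℕ∞) (Complex.ofRealCLM ∘ g) := by fun_prop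
  set φ : 𝓢(E, ℂ) := hg₁.toSchwartzMap hg₂ with hφ
  have hφg : ∀ x, φ x = (g x : ℂ) := fun x => by simp [hφ]
  -- Writing the test function as the transform of `𝓕⁻ φ` and exchanging integrals makes the pairing
  -- depend on `f` only through `𝓕 f`.
  have key : ∀ f : E → ℂ, Integrable f → ∫ x, g x • f x = ∫ ξ, (𝓕⁻ φ : 𝓢(E, ℂ)) ξ • 𝓕 f ξ := by
    intro f hf
    have := VectorFourier.integral_fourierIntegral_smul_eq_flip (μ := volume) (ν := volume)
      (L := innerₗ E) Real.continuous_fourierChar (continuous_inner (𝕜 := ℝ)) (𝓕⁻ φ : 𝓢(E, ℂ)).integrable hf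
    rw [flip_innerₗ] at this
    have h2 : ∀ ξ, VectorFourier.fourierIntegral Real.fourierChar volume (innerₗ E)
        (𝓕⁻ φ : 𝓢(E, ℂ)) ξ = φ ξ := by
      intro ξ
      have h3 : (𝓕 (𝓕⁻ φ : 𝓢(E, ℂ)) : 𝓢(E, ℂ)) ξ = φ ξ := by rw [fourier_fourierInv_eq]
      rw [← h3, SchwartzMap.fourier_coe]
      rfl
    simp_rw [h2, hφg] at this
    simpa using! this
  rw [key f hf, key f' hf']
  simp_rw [h]

/-- Lines through `H⁺` reach exactly these nonzero frequencies; continuity of the Fourier transform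
supplies the rest. -/
theorem dense_last_ne_zero : Dense {ξ : Eu (d + 1) | ξ (Fin.last d) ≠ 0} := by
  intro ξ
  rw [mem_closure_iff_seq_limit]
  by_cases h : ξ (Fin.last d) = 0
  · refine ⟨fun n => ξ + (1 / ((n : ℝ) + 1)) • EuclideanSpace.single (Fin.last d) (1 : ℝ),
      fun n => ?_, ?_⟩
    · have : ((n : ℝ) + 1) ≠ 0 := by positivity
      simp [h, this]
    · have := (tendsto_one_div_add_atTop_nhds_zero_nat (𝕜 := ℝ)).smul_const
        (EuclideanSpace.single (Fin.last d) (1 : ℝ))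
      simpa using this.const_add ξ
  · exact ⟨fun _ => ξ, fun _ => h, tendsto_const_nhds⟩

theorem isOpen_Hplus : IsOpen (Hplus d) := by
  have : Continuous fun s : Sph d => (s : Eu (d + 1)) (Fin.last d) := by fun_prop
  exact isOpen_lt continuous_const this

theorem sphMeasure_pos_of_isOpen {N : Set (Sph d)} (hN : IsOpen N) {s : Sph d} (hs : s ∈ N) :
    0 < sphMeasure d N := by
  have : (sphMeasure d).IsOpenPosMeasure := by unfold sphMeasure; infer_instance
  exact hN.measure_pos _ ⟨s, hs⟩

/-- If a property holds for almost every direction of `H⁺`, it holds on a dense set of them. -/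
theorem mem_closure_of_ae_Hplus {p : Sph d → Prop}
    (h : ∀ᵐ s ∂((sphMeasure d).restrict (Hplus d)), p s) {s : Sph d} (hs : s ∈ Hplus d) :
    s ∈ closure {s | p s} := by
  rw [mem_closure_iff]
  intro N hN hsN
  by_contra hne
  rw [not_nonempty_iff_eq_empty] at hne
  have h0 : (sphMeasure d).restrict (Hplus d) N = 0 :=
    measure_mono_null (fun x hx hpx => (hne ▸ (⟨hx, hpx⟩ : x ∈ N ∩ {s | p s}) :
      x ∈ (∅ : Set (Sph d)))) (ae_iff.mp h)
  rw [Measure.restrict_apply hN.measurableSet] at h0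
  exact (sphMeasure_pos_of_isOpen (hN.inter isOpen_Hplus) ⟨hsN, hs⟩).ne' h0

/-- The Radon transform is injective on `L¹`, from its values on almost every hyperplane. -/
theorem ae_eq_of_radon_ae_eq {f f' : Eu (d + 1) → ℂ} (hf : Integrable f) (hf' : Integrable f')
    (h : ∀ᵐ s ∂((sphMeasure d).restrict (Hplus d)), radon f s =ᵐ[volume] radon f' s) :
    f =ᵐ[volume] f' := by
  have hcont : ∀ {f : Eu (d + 1) → ℂ}, Integrable f → Continuous (𝓕 f : Eu (d + 1) → ℂ) :=
    fun hf => VectorFourier.fourierIntegral_continuous Real.continuous_fourierChar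
      (continuous_inner (𝕜 := ℝ)) hf
  -- The slice theorem gives equality for almost every direction; continuity in `s` extends it to
  -- every direction of `H⁺`.
  have hray : ∀ s ∈ Hplus d, ∀ σ : ℝ,
      𝓕 f (σ • (s : Eu (d + 1))) = 𝓕 f' (σ • (s : Eu (d + 1))) := by
    intro s hs σ
    have hc : IsClosed {s : Sph d | 𝓕 f (σ • (s : Eu (d + 1))) = 𝓕 f' (σ • (s : Eu (d + 1)))} :=
      isClosed_eq ((hcont hf).comp (by fun_prop)) ((hcont hf').comp (by fun_prop))
    refine hc.closure_subset_iff.mpr ?_ (mem_closure_of_ae_Hplus h hs)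
    intro s hs
    simp only [mem_ofPred_eq] at hs ⊢
    rw [fourier_smul_eq_integral_radon hf, fourier_smul_eq_integral_radon hf']
    refine integral_congr_ae ?_
    filter_upwards [hs] with u hu
    rw [hu]
  refine ae_eq_of_fourier_eq hf hf' fun ξ => ?_
  have hc : IsClosed {ξ | 𝓕 f ξ = 𝓕 f' ξ} := isClosed_eq (hcont hf) (hcont hf')
  refine hc.closure_subset_iff.mpr ?_ (dense_last_ne_zero ξ)
  intro ξ (hξ : ξ (Fin.last d) ≠ 0)
  have hξ0 : ξ ≠ 0 := fun h => hξ (by simp [h])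
  have hn : ‖ξ‖ ≠ 0 := norm_ne_zero_iff.mpr hξ0
  have hn' : 0 < ‖ξ‖ := norm_pos_iff.mpr hξ0
  rcases hξ.lt_or_gt with hlt | hgt
  -- A frequency in the lower half-space lies on the line of the opposite direction, at the negative
  -- parameter `-‖ξ‖`.
  · have h1 := hray ⟨(-‖ξ‖⁻¹) • ξ, by simp [norm_smul, hn]⟩
      (by simpa [Hplus] using mul_neg_of_pos_of_neg (inv_pos.mpr hn') hlt) (-‖ξ‖)
    simpa [smul_smul, hn] using h1
  · have h1 := hray ⟨‖ξ‖⁻¹ • ξ, by simp [norm_smul, hn]⟩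
      (by simpa [Hplus] using mul_pos (inv_pos.mpr hn') hgt) ‖ξ‖
    simpa [smul_smul, hn] using h1

/-- The inverse Radon transform at a point where the averages of the preimage converge. -/
theorem invRadon_eq {h : Sph d × ℝ → ℂ} {f : Eu (d + 1) → ℂ} (hf : IsInvRadon h f)
    {γ : Eu (d + 1)} {c : ℂ}
    (hγ : Tendsto (fun a => ⨍ y in a, f y)
      ((IsUnifLocDoublingMeasure.vitaliFamily (volume : Measure (Eu (d + 1))) 1).filterAt γ)
      (𝓝 c)) :
    invRadon h γ = c := by
  have hex : ∃ f : Eu (d + 1) → ℂ, IsInvRadon h f := ⟨f, hf⟩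
  rw [invRadon, dif_pos hex]
  -- By injectivity the chosen preimage is a version of `f`, hence has the same averages over balls.
  have hae : hex.choose =ᵐ[volume] f := by
    refine ae_eq_of_radon_ae_eq hex.choose_spec.1 hf.1 ?_
    filter_upwards [hex.choose_spec.2, hf.2] with s h1 h2
    filter_upwards [h1, h2] with u h1 h2
    rw [h1, h2]
  have hav : ∀ r : ℝ, ⨍ y in Metric.closedBall γ r, hex.choose y
      = ⨍ y in Metric.closedBall γ r, f y := fun r =>
    average_congr (ae_restrict_of_ae hae)
  simp_rw [hav]
  refine Tendsto.limUnder_eq (hγ.comp ?_)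
  exact IsUnifLocDoublingMeasure.tendsto_closedBall_filterAt _ (fun _ => γ) id tendsto_id
    (by
      filter_upwards [self_mem_nhdsWithin] with r hr
      exact Metric.mem_closedBall_self (by simpa using le_of_lt hr))

end RadonTransform

/-! ### Several unobservables -/

section Vector

/-- In the first alternative the derivative within the support is an ordinary derivative. In the
second it is zero whatever the shape of the support section, which agrees with the extension by
zero. -/
theorem dvRegressionDir_eq {𝕊 : Type*} [TopologicalSpace 𝕊] [MeasurableSpace 𝕊]
    {Q : Measure (ℝ × ℝ × 𝕊 × ℝ)} {w : ℝ → ℝ → ℂ} {M : 𝕊 × ℝ → ℂ}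
    (hreg : ∀ p ∈ (Q.map fun p => p.2.2).support, regression Q w p = M p) {s : 𝕊} {u : ℝ} {r : ℂ}
    (hd : HasDerivAt (fun u => M (s, u)) r u)
    (hcase : (∀ᶠ u' in 𝓝 u, (s, u') ∈ (Q.map fun p => p.2.2).support) ∨
      ∃ c, ∀ᶠ u' in 𝓝 u, M (s, u') = c) :
    dvRegressionDir Q w (s, u) = r := by
  simp only [dvRegressionDir]
  set C := (Q.map fun p => p.2.2).support with hC
  rcases hcase with hin | ⟨c, hc⟩
  · have hu : (s, u) ∈ C := hin.self_of_nhds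
    rw [if_pos hu, derivWithin_of_mem_nhds hin]
    refine (hd.congr_of_eventuallyEq ?_).deriv
    filter_upwards [hin] with u' hu'
    exact hreg _ hu'
  · have hr : r = 0 := by
      refine hd.unique ((hasDerivAt_const u c).congr_of_eventuallyEq ?_)
      exact hc
    split_ifs with hu
    · rw [hr]
      have heq : (fun u => regression Q w (s, u)) =ᶠ[𝓝[{u | (s, u) ∈ C}] u] fun _ => c := by
        filter_upwards [self_mem_nhdsWithin, mem_nhdsWithin_of_mem_nhds hc] with u' h1 h2
        rw [hreg _ h1, h2]
      rw [heq.derivWithin_eq (by rw [hreg _ hu, hc.self_of_nhds])]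
      simp
    · exact hr.symm

/-- For almost every `a`, the section at `a` of the joint support is closed and of full `η a`
measure, so it contains the support of `η a`. -/
theorem ae_forall_mem_support_compProd {α β : Type*} [TopologicalSpace α] [TopologicalSpace β]
    [MeasurableSpace α] [MeasurableSpace β]
    [HereditarilyLindelofSpace (α × β)] {ρ : Measure α} [SFinite ρ]
    {η : Kernel α β} [IsSFiniteKernel η] :
    ∀ᵐ a ∂ρ, ∀ b ∈ (η a).support, (a, b) ∈ (ρ ⊗ₘ η).support := by
  have h : ∀ᵐ p ∂(ρ ⊗ₘ η), p ∈ (ρ ⊗ₘ η).support := Measure.support_mem_ae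
  filter_upwards [Measure.ae_ae_of_ae_compProd h] with a ha b hb
  exact Measure.support_subset_of_isClosed
    (Measure.isClosed_support.preimage (Continuous.prodMk_right a)) ha hb

variable {d : ℕ}

/-- Under the large support condition, the support of the instruments contains the interior of the
range of the index `⟪s, γ⟫`, in every direction `s` of the closed hemisphere. -/
theorem mem_support_of_largeSupport {ρ : Measure (Sph d)} [SFinite ρ] {η : Kernel (Sph d) ℝ}
    [IsSFiniteKernel η] {K : Set (Eu (d + 1))}
    (hlarge : ∀ᵐ s : Sph d ∂ρ, ∀ u : ℝ,
      (⨅ γ ∈ K, ((inner ℝ (s : Eu (d + 1)) γ : ℝ) : EReal)) ≤ u →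
      (u : EReal) ≤ (⨆ γ ∈ K, ((inner ℝ (s : Eu (d + 1)) γ : ℝ) : EReal)) →
      u ∈ (η s).support)
    {s : Sph d} (hs : s ∈ ρ.support) {u : ℝ} {γ₁ γ₂ : Eu (d + 1)} (hγ₁ : γ₁ ∈ K) (hγ₂ : γ₂ ∈ K)
    (h₁ : inner ℝ (s : Eu (d + 1)) γ₁ < u) (h₂ : u < inner ℝ (s : Eu (d + 1)) γ₂) :
    (s, u) ∈ (ρ ⊗ₘ η).support := by
  rw [← Measure.isClosed_support.closure_eq, mem_closure_iff_nhds]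
  intro N hN
  have hN' : ∀ᶠ s' in 𝓝 s, (s', u) ∈ N :=
    (Continuous.prodMk_left u).continuousAt.eventually hN
  have hc : ∀ γ : Eu (d + 1), Continuous fun s : Sph d => (inner ℝ (s : Eu (d + 1)) γ : ℝ) :=
    fun γ => by fun_prop
  -- The strict inequalities persist for directions near `s`. Such directions have positive mass
  -- because `s` is in the support, so one of them satisfies the almost-sure large support
  -- condition.
  have hopen := (hN'.and (((hc γ₁).continuousAt.eventually (gt_mem_nhds h₁)).and
    ((hc γ₂).continuousAt.eventually (lt_mem_nhds h₂))))
  have hpos := (Measure.mem_support_iff_forall s).mp hs _ hopen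
  have hgood := hlarge.and (ae_forall_mem_support_compProd (ρ := ρ) (η := η))
  rw [← measure_inter_conull (t := {s' | _}) (ae_iff.mp hgood)] at hpos
  obtain ⟨s', ⟨hs'N, hs'1, hs'2⟩, hs'l, hs'c⟩ := nonempty_of_measure_ne_zero hpos.ne'
  refine ⟨(s', u), hs'N, hs'c u (hs'l u ?_ ?_)⟩
  · exact (iInf₂_le γ₁ hγ₁).trans (EReal.coe_le_coe_iff.mpr hs'1.le)
  · exact (EReal.coe_le_coe_iff.mpr hs'2.le).trans (le_iSup₂ (f := fun γ (_ : γ ∈ K) =>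
      ((inner ℝ (s' : Eu (d + 1)) γ : ℝ) : EReal)) γ₂ hγ₂)

/-- Away from the two endpoints, a point is inside the range of the index, or the index almost
surely stays on one side of all nearby points. -/
theorem interior_or_eventually_const {ν : Measure (Eu (d + 1))} {φ : Eu (d + 1) → ℂ} (s : Sph d)
    {u : ℝ} (hglb : ¬ IsGLB ((fun γ => inner ℝ (s : Eu (d + 1)) γ) '' ν.support) u)
    (hlub : ¬ IsLUB ((fun γ => inner ℝ (s : Eu (d + 1)) γ) '' ν.support) u) :
    ((∃ γ ∈ ν.support, inner ℝ (s : Eu (d + 1)) γ < u) ∧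
      ∃ γ ∈ ν.support, u < inner ℝ (s : Eu (d + 1)) γ) ∨
    ∃ c, ∀ᶠ u' in 𝓝 u, ∫ γ in {γ | inner ℝ (s : Eu (d + 1)) γ < u'}, φ γ ∂ν = c := by
  have hK : ∀ᵐ γ ∂ν, γ ∈ ν.support := Measure.support_mem_ae
  by_cases h1 : ∃ γ ∈ ν.support, inner ℝ (s : Eu (d + 1)) γ < u
  · by_cases h2 : ∃ γ ∈ ν.support, u < inner ℝ (s : Eu (d + 1)) γ
    · exact Or.inl ⟨h1, h2⟩
    · right
      push Not at h2
      have hub : u ∈ upperBounds ((fun γ => inner ℝ (s : Eu (d + 1)) γ) '' ν.support) := by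
        rintro _ ⟨γ, hγ, rfl⟩; exact h2 γ hγ
      -- Since `u` bounds the index but is not its least upper bound, there is room below `u`: for
      -- every `u'` above `b` the half-space has full mass.
      obtain ⟨b, hb, hbu⟩ : ∃ b ∈ upperBounds
          ((fun γ => inner ℝ (s : Eu (d + 1)) γ) '' ν.support), b < u := by
        by_contra hcon
        push Not at hcon
        exact hlub ⟨hub, hcon⟩
      refine ⟨∫ γ, φ γ ∂ν, ?_⟩
      filter_upwards [lt_mem_nhds hbu] with u' hu'
      refine setIntegral_eq_integral_of_ae_compl_eq_zero ?_
      filter_upwards [hK] with γ hγ hγ'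
      exact absurd ((hb ⟨γ, hγ, rfl⟩).trans_lt hu') hγ'
  · right
    push Not at h1
    have hlb : u ∈ lowerBounds ((fun γ => inner ℝ (s : Eu (d + 1)) γ) '' ν.support) := by
      rintro _ ⟨γ, hγ, rfl⟩; exact h1 γ hγ
    obtain ⟨b, hb, hbu⟩ : ∃ b ∈ lowerBounds
        ((fun γ => inner ℝ (s : Eu (d + 1)) γ) '' ν.support), u < b := by
      by_contra hcon
      push Not at hcon
      exact hglb ⟨hlb, hcon⟩
    refine ⟨0, ?_⟩
    filter_upwards [gt_mem_nhds hbu] with u' hu'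
    refine setIntegral_measure_zero _ (measure_mono_null
      (t := {γ | ¬ γ ∈ ν.support}) (fun γ hγ hγ' => ?_) (ae_iff.mp hK))
    exact absurd (hb ⟨γ, hγ', rfl⟩) (not_le.mpr (lt_trans hγ hu'))

/-- If the regression is the integral of `φ` over half-spaces up to a constant, its derivative is
the Radon transform of `φ` times the density of the unobservables. -/
theorem isInvRadon_dvRegressionDir {Q : Measure (ℝ × ℝ × Sph d × ℝ)} {w : ℝ → ℝ → ℂ}
    {ν : Measure (Eu (d + 1))} [SigmaFinite ν] {φ : Eu (d + 1) → ℂ} {c : ℂ}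
    {F : Eu (d + 1) → ℂ} (hF : Integrable F)
    (hφF : ∀ A : Set (Eu (d + 1)), MeasurableSet A → ∫ γ in A, φ γ ∂ν = ∫ γ in A, F γ)
    (hreg : ∀ p ∈ (Q.map fun p => p.2.2).support,
      regression Q w p = (∫ γ in {γ | inner ℝ (p.1 : Eu (d + 1)) γ < p.2}, φ γ ∂ν) + c)
    (hint : ∀ s ∈ Hplus d, ∀ u : ℝ, (∃ γ ∈ ν.support, inner ℝ (s : Eu (d + 1)) γ < u) →
      (∃ γ ∈ ν.support, u < inner ℝ (s : Eu (d + 1)) γ) →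
      (s, u) ∈ (Q.map fun p => p.2.2).support) :
    IsInvRadon (dvRegressionDir Q w) F := by
  refine ⟨hF, ?_⟩
  filter_upwards [ae_restrict_mem isOpen_Hplus.measurableSet] with s hs
  have hav := (IsUnifLocDoublingMeasure.vitaliFamily (volume : Measure ℝ) 1).ae_tendsto_average
    (integrable_radon hF s).locallyIntegrable
  -- A set has at most one greatest lower bound and one least upper bound, so excluding the two
  -- endpoints in each direction costs a null set of `u`.
  have hsub : ∀ p : ℝ → Prop, {u | p u}.Subsingleton → ∀ᵐ u : ℝ, ¬ p u := by
    intro p hp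
    rw [ae_iff]
    simpa using hp.measure_zero volume
  filter_upwards [hav, hsub _ fun a ha b hb => IsGLB.unique ha hb,
    hsub _ fun a ha b hb => IsLUB.unique ha hb] with u hu hglb hlub
  symm
  refine dvRegressionDir_eq hreg (M := fun p : Sph d × ℝ =>
    (∫ γ in {γ | inner ℝ (p.1 : Eu (d + 1)) γ < p.2}, φ γ ∂ν) + c) ?_ ?_
  · refine HasDerivAt.add_const c ?_
    have heq : (fun u => ∫ γ in {γ | inner ℝ (s : Eu (d + 1)) γ < u}, φ γ ∂ν)
        = fun u => ∫ y in Iio u, radon F s y := by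
      funext u
      rw [hφF _ (measurableSet_lt (by fun_prop) measurable_const), setIntegral_halfSpace_eq hF]
    simp only [heq]
    exact hasDerivAt_integral_Iio_of_tendsto_average (integrable_radon hF s) hu
  · rcases interior_or_eventually_const (φ := φ) s hglb hlub with
      ⟨⟨γ₁, hγ₁, h₁⟩, γ₂, hγ₂, h₂⟩ | ⟨c', hc'⟩
    · left
      filter_upwards [lt_mem_nhds h₁, gt_mem_nhds h₂] with u' h1 h2
      exact hint s hs u' ⟨γ₁, hγ₁, h1⟩ ⟨γ₂, hγ₂, h2⟩
    · right
      refine ⟨c' + c, ?_⟩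
      filter_upwards [hc'] with u' hu'
      rw [hu']

theorem measure_hyperplane_eq_zero (s : Sph d) (u : ℝ) :
    (volume : Measure (Eu (d + 1))) {γ | inner ℝ (s : Eu (d + 1)) γ = u} = 0 := by
  have hmp := measurePreserving_smul_add_orthogonal (norm_coe_sph s)
  have hm : MeasurableSet {γ : Eu (d + 1) | inner ℝ (s : Eu (d + 1)) γ = u} :=
    measurableSet_eq_fun (by fun_prop) measurable_const
  rw [← hmp.measure_preimage hm.nullMeasurableSet]
  refine measure_mono_null (t := {u} ×ˢ univ) ?_ (by simp)
  intro p hp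
  refine ⟨?_, mem_univ _⟩
  have := inner_smul_add_orthogonal (norm_coe_sph s) p.1 p.2
  simp only [mem_preimage, mem_ofPred_eq] at hp
  rw [mem_singleton_iff, ← this, hp]

/-- Since `|φ_j| ≤ 1`, the function `φ_j f` is integrable and is an admissible Radon preimage of the
differentiated regression; its averages over balls converge for almost every `γ`, simultaneously in
`t`. -/
theorem ae_invRadon_dvRegressionDir_eq {Ω : Type*} [MeasurableSpace Ω] {P : Measure Ω}
    [IsProbabilityMeasure P] {Y₀ Y₁ Y D Vt : Ω → ℝ} {S : Ω → Sph d} {Γt : Ω → Eu (d + 1)}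
    {κ₀ κ₁ : Kernel (Eu (d + 1)) ℝ} [IsMarkovKernel κ₀] [IsMarkovKernel κ₁]
    {η : Kernel (Sph d) ℝ} [IsSFiniteKernel η]
    (hY₀ : Measurable Y₀) (hY₁ : Measurable Y₁) (hVt : Measurable Vt) (hS : Measurable S)
    (hΓt : Measurable Γt) (hY : Measurable Y) (hD : Measurable D)
    (hDA : ∀ ω, D ω = {ω' | inner ℝ (S ω' : Eu (d + 1)) (Γt ω') < Vt ω'}.indicator 1 ω)
    (hYD : ∀ ω, Y ω = Y₀ ω + (Y₁ ω - Y₀ ω) * D ω)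
    (hΓac : P.map Γt ≪ volume)
    (hind₀ : P.map (fun ω => ((S ω, Vt ω), Γt ω, Y₀ ω))
      = (P.map fun ω => (S ω, Vt ω)).prod (P.map fun ω => (Γt ω, Y₀ ω)))
    (hind₁ : P.map (fun ω => ((S ω, Vt ω), Γt ω, Y₁ ω))
      = (P.map fun ω => (S ω, Vt ω)).prod (P.map fun ω => (Γt ω, Y₁ ω)))
    (hκ₀ : P.map (fun ω => (Γt ω, Y₀ ω)) = P.map Γt ⊗ₘ κ₀)
    (hκ₁ : P.map (fun ω => (Γt ω, Y₁ ω)) = P.map Γt ⊗ₘ κ₁)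
    (hη : P.map (fun ω => (S ω, Vt ω)) = P.map S ⊗ₘ η)
    (hSsupp : (P.map S).support = closure (Hplus d))
    (hlarge : ∀ᵐ s : Sph d ∂(P.map S), ∀ u : ℝ,
      (⨅ γ ∈ (P.map Γt).support, ((inner ℝ (s : Eu (d + 1)) γ : ℝ) : EReal)) ≤ u →
      (u : EReal) ≤ (⨆ γ ∈ (P.map Γt).support, ((inner ℝ (s : Eu (d + 1)) γ : ℝ) : EReal)) →
      u ∈ (η s).support) :
    ∀ᵐ γ ∂(P.map Γt), ∀ t : ℝ,
      invRadon (dvRegressionDir (P.map fun ω => (Y ω, D ω, S ω, Vt ω)) (treatedWeight t)) γ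
        = charFun (κ₁ γ) t * (((P.map Γt).rnDeriv volume γ).toReal : ℂ) ∧
      invRadon (dvRegressionDir (P.map fun ω => (Y ω, D ω, S ω, Vt ω)) (untreatedWeight t)) γ
        = charFun (κ₀ γ) t * (((P.map Γt).rnDeriv volume γ).toReal : ℂ) := by
  have : IsProbabilityMeasure (P.map Γt) := Measure.isProbabilityMeasure_map hΓt.aemeasurable
  have : IsProbabilityMeasure (P.map S) := Measure.isProbabilityMeasure_map hS.aemeasurable
  set f : Eu (d + 1) → ℝ := fun γ => ((P.map Γt).rnDeriv volume γ).toReal with hf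
  have hfi : Integrable f := Measure.integrable_toReal_rnDeriv
  set A : Set ((Sph d × ℝ) × Eu (d + 1)) :=
    {p | inner ℝ (p.1.1 : Eu (d + 1)) p.2 < p.1.2} with hA
  have hAm : MeasurableSet A := measurableSet_lt (by fun_prop) (by fun_prop)
  have hDA' : ∀ ω, D ω = A.indicator 1 ((S ω, Vt ω), Γt ω) := by
    intro ω
    rw [hDA ω]
    by_cases h : inner ℝ (S ω : Eu (d + 1)) (Γt ω) < Vt ω <;> simp [hA, h]
  have hpre : ∀ p : Sph d × ℝ, Prod.mk p ⁻¹' A = {γ | inner ℝ (p.1 : Eu (d + 1)) γ < p.2} :=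
    fun p => rfl
  have hQU : (P.map fun ω => (Y ω, D ω, S ω, Vt ω)).map (fun p => p.2.2)
      = P.map fun ω => (S ω, Vt ω) := by
    rw [Measure.map_map (by fun_prop) (by fun_prop)]; rfl
  have hcont : ∀ (κ : Kernel (Eu (d + 1)) ℝ) [IsMarkovKernel κ] (t : ℝ),
      Continuous fun p : Sph d × ℝ => ∫ g in Prod.mk p ⁻¹' A, charFun (κ g) t ∂(P.map Γt) := by
    intro κ _ t
    have hs : ∀ p : Sph d × ℝ, {γ | inner ℝ (p.1 : Eu (d + 1)) γ < p.2}
        = {γ : Eu (d + 1) | 0 < p.2 - inner ℝ (p.1 : Eu (d + 1)) γ} := fun p => by ext g; simp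
    simp_rw [hpre, hs]
    refine continuous_setIntegral_of_threshold
      (Integrable.of_bound (measurable_charFun_kernel κ t).aestronglyMeasurable 1
        (Eventually.of_forall fun _ => norm_charFun_le_one _)) (by fun_prop)
      (by fun_prop) fun p => ?_
    rw [ae_iff]
    simp only [ne_eq, not_not, sub_eq_zero]
    -- Hyperplanes are Lebesgue-null, so the index almost surely misses the threshold, which gives
    -- continuity of the regression.
    exact hΓac (measure_mono_null (fun x hx => hx.symm) (measure_hyperplane_eq_zero p.1 p.2))
  have hint : ∀ s ∈ Hplus d, ∀ u : ℝ,
      (∃ γ ∈ (P.map Γt).support, inner ℝ (s : Eu (d + 1)) γ < u) →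
      (∃ γ ∈ (P.map Γt).support, u < inner ℝ (s : Eu (d + 1)) γ) →
      (s, u) ∈ ((P.map fun ω => (Y ω, D ω, S ω, Vt ω)).map fun p => p.2.2).support := by
    rintro s hs u ⟨γ₁, hγ₁, h₁⟩ ⟨γ₂, hγ₂, h₂⟩
    rw [hQU, hη]
    exact mem_support_of_largeSupport hlarge (hSsupp ▸ subset_closure hs) hγ₁ hγ₂ h₁ h₂
  have hinv₁ : ∀ t : ℝ, IsInvRadon
      (dvRegressionDir (P.map fun ω => (Y ω, D ω, S ω, Vt ω)) (treatedWeight t))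
      fun γ => charFun (κ₁ γ) t * (f γ : ℂ) := by
    intro t
    refine isInvRadon_dvRegressionDir (integrable_charFun_mul κ₁ hfi t) (c := 0)
      (fun B hB => setIntegral_charFun_eq hΓac κ₁ t hB) (fun p hp => ?_) hint
    rw [add_zero]
    exact regression_treatedWeight hY hD hY₁ (hS.prodMk hVt) hΓt hAm hDA' hYD hind₁ hκ₁
      (hcont κ₁ t) (hQU ▸ hp)
  have hinv₀ : ∀ t : ℝ, IsInvRadon
      (dvRegressionDir (P.map fun ω => (Y ω, D ω, S ω, Vt ω)) (untreatedWeight t))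
      fun γ => charFun (κ₀ γ) t * (f γ : ℂ) := by
    intro t
    refine isInvRadon_dvRegressionDir (integrable_charFun_mul κ₀ hfi t)
      (c := - ∫ g, charFun (κ₀ g) t ∂(P.map Γt))
      (fun B hB => setIntegral_charFun_eq hΓac κ₀ t hB) (fun p hp => ?_) hint
    rw [← sub_eq_add_neg]
    exact regression_untreatedWeight hY hD hY₀ (hS.prodMk hVt) hΓt hAm hDA' hYD hind₀ hκ₀
      (hcont κ₀ t) (hQU ▸ hp)
  have hder := fun (κ : Kernel (Eu (d + 1)) ℝ) [IsMarkovKernel κ] =>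
    ae_forall_tendsto_average_charFun
      (IsUnifLocDoublingMeasure.vitaliFamily (volume : Measure (Eu (d + 1))) 1) κ
      (fun _ => ENNReal.toReal_nonneg) hfi
  filter_upwards [hΓac.ae_le (hder κ₀), hΓac.ae_le (hder κ₁)] with γ h₀ h₁ t
  exact ⟨invRadon_eq (hinv₁ t) (h₁ t), invRadon_eq (hinv₀ t) (h₀ t)⟩

end Vector

/-! ### Identification of the conditional density of treatment effects -/

section Identification

theorem indepFun_map_prodMk {Ω α β α' β' : Type*} [MeasurableSpace Ω] [MeasurableSpace α]
    [MeasurableSpace β] [MeasurableSpace α'] [MeasurableSpace β'] {P : Measure Ω}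
    [IsProbabilityMeasure P] {A : Ω → α} {B : Ω → β} (hA : Measurable A) (hB : Measurable B)
    (h : P.map (fun ω => (A ω, B ω)) = (P.map A).prod (P.map B)) {f : α → α'} {g : β → β'}
    (hf : Measurable f) (hg : Measurable g) :
    P.map (fun ω => (f (A ω), g (B ω)))
      = (P.map fun ω => f (A ω)).prod (P.map fun ω => g (B ω)) := by
  have h1 : IndepFun A B P :=
    (indepFun_iff_map_prod_eq_prod_map_map hA.aemeasurable hB.aemeasurable).mpr h
  exact (indepFun_iff_map_prod_eq_prod_map_map (hf.comp hA).aemeasurable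
    (hg.comp hB).aemeasurable).mp (h1.comp hf hg)

theorem ae_absolutelyContinuous_of_compProd {α : Type*} [MeasurableSpace α] {m ν : Measure α}
    [SFinite ν] [SFinite m] {κ : Kernel α ℝ} [IsFiniteKernel κ]
    (h : ν ⊗ₘ κ ≪ m.prod (volume : Measure ℝ)) : ∀ᵐ g ∂ν, κ g ≪ volume := by
  -- Lebesgue measure is replaced by an equivalent finite measure, viewed as a constant kernel.
  have h' : ν ⊗ₘ κ ≪ m ⊗ₘ Kernel.const α (volume : Measure ℝ).toFinite := by
    rw [Measure.compProd_const]
    exact h.trans (Measure.AbsolutelyContinuous.rfl.prod (absolutelyContinuous_toFinite volume))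
  filter_upwards [h'.kernel_of_compProd] with g hg
  exact hg.trans (toFinite_absolutelyContinuous volume)

/-- For each fixed `y₀` the map is a translation followed by a swap, hence measure preserving;
dropping `y₀` keeps null sets null. This gives `(G, Δ)` a density. -/
theorem quasiMeasurePreserving_sub_prod {α : Type*} [MeasurableSpace α] (m : Measure α)
    [SigmaFinite m] :
    Measure.QuasiMeasurePreserving (fun p : ℝ × ℝ × α => (p.2.2, p.2.1 - p.1))
      ((volume : Measure ℝ).prod ((volume : Measure ℝ).prod m)) (m.prod volume) := by
  have h := (MeasurePreserving.id (volume : Measure ℝ)).skew_product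
    (g := fun (y₀ : ℝ) (q : ℝ × α) => (q.2, q.1 - y₀)) (μc := (volume : Measure ℝ).prod m)
    (μd := m.prod volume) (by fun_prop) (Eventually.of_forall fun y₀ => ?_)
  · exact (Measure.quasiMeasurePreserving_snd).comp h.quasiMeasurePreserving
  · exact (((MeasurePreserving.id m).prod (measurePreserving_sub_right volume y₀)).comp
      Measure.measurePreserving_swap).map_eq

theorem absolutelyContinuous_map_of_quasi {Ω α β : Type*} [MeasurableSpace Ω] [MeasurableSpace α]
    [MeasurableSpace β] {P : Measure Ω} {W : Ω → α} {m : Measure α} {n : Measure β}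
    (hW : Measurable W) (h : P.map W ≪ m) {f : α → β} (hf : Measure.QuasiMeasurePreserving f m n) :
    P.map (fun ω => f (W ω)) ≪ n := by
  have : P.map (fun ω => f (W ω)) = (P.map W).map f := by
    rw [Measure.map_map hf.measurable hW]; rfl
  rw [this]
  exact (h.map hf.measurable).trans hf.absolutelyContinuous

/-- The ratio of the two transforms is the characteristic function of the treatment effect. -/
theorem isFourierInversion_div {ρ₀ ρ₁ ρ : Measure ℝ} [IsFiniteMeasure ρ] (hρ : ρ ≪ volume)
    (hu : MemLp (fun δ => (ρ.rnDeriv volume δ).toReal) 2 volume)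
    (hchar : ∀ t, charFun ρ₁ t = charFun ρ₀ t * charFun ρ t) (h₀ : ∀ t, charFun ρ₀ t ≠ 0)
    {f : ℂ} (hf : f ≠ 0) {num den : ℝ → ℂ} (hnum : ∀ t, num t = charFun ρ₁ t * f)
    (hden : ∀ t, den t = charFun ρ₀ t * f) :
    IsFourierInversion (fun δ => (ρ.rnDeriv volume δ).toReal) (fun t => num t / den t) := by
  have : (fun t => num t / den t) = charFun ρ := by
    funext t
    rw [hnum, hden, hchar]
    field_simp [h₀ t]
  rw [this]
  exact isFourierInversion_charFun hρ hu

/-- Allows the density of the unobservables to be cancelled in the ratio. -/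
theorem ae_rnDeriv_toReal_ne_zero {α : Type*} [MeasurableSpace α] {ν m : Measure α}
    [SigmaFinite ν] [SigmaFinite m] (h : ν ≪ m) :
    ∀ᵐ g ∂ν, ((ν.rnDeriv m g).toReal : ℂ) ≠ 0 := by
  filter_upwards [Measure.rnDeriv_pos h, h.ae_le (Measure.rnDeriv_lt_top ν m)] with g h1 h2
  exact_mod_cast (ENNReal.toReal_pos h1.ne' h2.ne).ne'

theorem identification_scalar {Ω 𝒳 : Type*} [MeasurableSpace Ω] [MeasurableSpace 𝒳]
    (μ : Measure Ω) [IsProbabilityMeasure μ] {Y₀ Y₁ Δ Y D V Θ : Ω → ℝ} {X : Ω → 𝒳}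
    (hY₀ : Measurable Y₀) (hY₁ : Measurable Y₁) (hV : Measurable V) (hΘ : Measurable Θ)
    (hX : Measurable X) (hΔ : ∀ ω, Δ ω = Y₁ ω - Y₀ ω) (hY : ∀ ω, Y ω = Y₀ ω + Δ ω * D ω)
    (hD : ∀ ω, D ω = Set.indicator {ω' | V ω' - Θ ω' > 0} 1 ω)
    (hac : ∀ᵐ x ∂(μ.map X), condDistrib (fun ω => (V ω, Y₀ ω, Y₁ ω, Θ ω)) X μ x ≪ volume)
    (hi₀ : CondIndepGiven μ V (fun ω => (Y₀ ω, Θ ω)) X)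
    (hi₁ : CondIndepGiven μ V (fun ω => (Y₁ ω, Θ ω)) X)
    (hiΔ : CondIndepGiven μ Y₀ Δ (fun ω => (Θ ω, X ω)))
    (hmem : ∀ᵐ x ∂(μ.map X), ∀ᵐ θ ∂(condDistrib Θ X μ x),
      MemLp (fun δ => UCDITE μ Δ Θ X δ θ x) 2 volume)
    (hchar : ∀ᵐ x ∂(μ.map X), ∀ᵐ θ ∂(condDistrib Θ X μ x),
      ∀ t : ℝ, charFun (condDistrib Y₀ (fun ω => (Θ ω, X ω)) μ (θ, x)) t ≠ 0) :
    ∀ᵐ x ∂(μ.map X), ∀ᵐ θ ∂(condDistrib Θ X μ x), θ ∈ (condDistrib V X μ x).support →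
      condDistrib Δ (fun ω => (Θ ω, X ω)) μ (θ, x) ≪ volume ∧
      IsFourierInversion (fun δ => UCDITE μ Δ Θ X δ θ x)
        (fun t =>
          dvRegression (condDistrib (fun ω => (Y ω, D ω, V ω)) X μ x) (treatedWeight t) θ /
          dvRegression (condDistrib (fun ω => (Y ω, D ω, V ω)) X μ x) (untreatedWeight t) θ) := by
  have hΔm : Measurable Δ := by rw [funext hΔ]; fun_prop
  -- Every variable involved is a measurable function of these primitives, so for almost every `x`
  -- all the conditional laws given `X = x` are images of one measure on `ℝ⁴`, and the problem loses
  -- its covariates.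
  set W : Ω → ℝ × ℝ × ℝ × ℝ := fun ω => (V ω, Y₀ ω, Y₁ ω, Θ ω) with hWdef
  have hW : Measurable W := by fun_prop
  set D' : ℝ × ℝ × ℝ × ℝ → ℝ := {w | w.1 - w.2.2.2 > 0}.indicator 1 with hD'
  have hD'm : Measurable D' :=
    measurable_one.indicator (measurableSet_lt measurable_const (by fun_prop))
  set Y' : ℝ × ℝ × ℝ × ℝ → ℝ := fun w => w.2.1 + (w.2.2.1 - w.2.1) * D' w with hY'
  have hY'm : Measurable Y' := by fun_prop
  have hobs : (fun ω => (Y ω, D ω, V ω)) = fun ω => (fun w => (Y' w, D' w, w.1)) (W ω) := by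
    have hDW : ∀ ω, D ω = D' (W ω) := fun ω => by rw [hD ω]; rfl
    funext ω
    simp only [hY', hY, hΔ, hDW]
    rfl
  have hΔW : (fun ω => (Θ ω, Δ ω)) = fun ω => (fun w : ℝ × ℝ × ℝ × ℝ =>
      (w.2.2.2, w.2.2.1 - w.2.1)) (W ω) := by
    funext ω; simp only [hΔ]; rfl
  have hchar₁ := ae_ae_of_ae_map_prodMk hΘ hX
    (ae_charFun_condDistrib_add (Y₁ := Y₁) hY₀ hΔm (fun ω => by rw [hΔ ω]; ring) hiΔ)
  have map := fun {β : Type} [MeasurableSpace β] [StandardBorelSpace β] [Nonempty β]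
    {f : ℝ × ℝ × ℝ × ℝ → β} (hf : Measurable f) => ae_condDistrib_map (μ := μ) (X := X) hW hf
  filter_upwards [hac, hi₀, hi₁, hmem, hchar, hchar₁,
    ae_condDistrib_prodMk (μ := μ) hY₀ hΘ hX, ae_condDistrib_prodMk (μ := μ) hY₁ hΘ hX,
    ae_condDistrib_prodMk (μ := μ) hΔm hΘ hX,
    map (f := fun w => (Y' w, D' w, w.1)) (by fun_prop),
    map (f := fun w => w.1) (by fun_prop), map (f := fun w => w.2.2.2) (by fun_prop),
    map (f := fun w => (w.1, w.2.1, w.2.2.2)) (by fun_prop),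
    map (f := fun w => (w.2.1, w.2.2.2)) (by fun_prop),
    map (f := fun w => (w.1, w.2.2.1, w.2.2.2)) (by fun_prop),
    map (f := fun w => (w.2.2.1, w.2.2.2)) (by fun_prop),
    map (f := fun w => (w.2.2.2, w.2.1)) (by fun_prop),
    map (f := fun w => (w.2.2.2, w.2.2.1)) (by fun_prop),
    map (f := fun w => (w.2.2.2, w.2.2.1 - w.2.1)) (by fun_prop)]
    with x hac hi₀ hi₁ hmem hchar hchar₁ hκ₀ hκ₁ hκΔ eobs eV eΘ eV0 e0 eV1 e1 eΘ0 eΘ1 eΘΔ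
  rw [← hobs] at eobs
  rw [← hΔW] at eΘΔ
  simp only [hWdef] at eobs eV eΘ eV0 e0 eV1 e1 eΘ0 eΘ1 eΘΔ
  set P := condDistrib W X μ x with hP
  rw [eV0, eV, e0] at hi₀
  rw [eV1, eV, e1] at hi₁
  rw [eΘ0, eΘ] at hκ₀
  rw [eΘ1, eΘ] at hκ₁
  rw [eΘΔ, eΘ] at hκΔ
  rw [eΘ] at hmem hchar hchar₁ ⊢
  rw [eV, eobs]
  have hPid : P.map (fun w => w) ≪ volume := by rwa [Measure.map_id']
  have hVac : P.map (fun w => w.1) ≪ volume :=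
    absolutelyContinuous_map_of_quasi measurable_id' hPid Measure.quasiMeasurePreserving_fst
  have hΘac : P.map (fun w => w.2.2.2) ≪ volume :=
    absolutelyContinuous_map_of_quasi measurable_id' hPid
      (Measure.quasiMeasurePreserving_snd.comp (Measure.quasiMeasurePreserving_snd.comp
        Measure.quasiMeasurePreserving_snd))
  have hΔac : P.map (fun w => (w.2.2.2, w.2.2.1 - w.2.1)) ≪ (volume : Measure ℝ).prod volume :=
    absolutelyContinuous_map_of_quasi measurable_id' hPid
      ((quasiMeasurePreserving_sub_prod (volume : Measure ℝ)).comp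
        Measure.quasiMeasurePreserving_snd)
  have hmain := ae_dvRegression_eq (P := P) (Y₀ := fun w => w.2.1) (Y₁ := fun w => w.2.2.1)
    (Y := Y') (D := D') (V := fun w => w.1) (Θ := fun w => w.2.2.2)
    (by fun_prop) (by fun_prop) (by fun_prop) (by fun_prop) hY'm hD'm (fun _ => rfl)
    (fun _ => rfl) hVac hΘac
    (indepFun_map_prodMk (by fun_prop) (by fun_prop) hi₀ measurable_id' measurable_swap)
    (indepFun_map_prodMk (by fun_prop) (by fun_prop) hi₁ measurable_id' measurable_swap)
    hκ₀ hκ₁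
  rw [hκΔ] at hΔac
  have : IsProbabilityMeasure (P.map fun w => w.2.2.2) :=
    Measure.isProbabilityMeasure_map (by fun_prop)
  filter_upwards [hmain, hmem, hchar, hchar₁, ae_absolutelyContinuous_of_compProd hΔac,
    ae_rnDeriv_toReal_ne_zero hΘac] with θ hmain hmem hchar hchar₁ hac hf hθ
  exact ⟨hac, isFourierInversion_div hac hmem hchar₁ hchar hf (fun t => (hmain hθ t).1)
    (fun t => (hmain hθ t).2)⟩

end Identification

/-! ### Geometry of the rescaled instruments -/

section RescaledInstruments

variable {d : ℕ}

/-- Transfers absolute continuity from the pair (`Θ`, `Γ`) to the stacked vector in `ℝ^{d+1}`. -/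
theorem measurePreserving_snocVec :
    MeasurePreserving (fun p : ℝ × Eu d => snocVec p.2 p.1)
      ((volume : Measure ℝ).prod volume) volume := by
  have h1 : MeasurePreserving (Prod.map id (@WithLp.ofLp 2 (Fin d → ℝ)) :
      ℝ × Eu d → ℝ × (Fin d → ℝ)) ((volume : Measure ℝ).prod volume) (volume.prod volume) :=
    (MeasurePreserving.id volume).prod (PiLp.volume_preserving_ofLp (Fin d))
  have h2 := (volume_preserving_piFinSuccAbove (fun _ : Fin (d + 1) => ℝ) (Fin.last d)).symm
  have h3 := PiLp.volume_preserving_toLp (Fin (d + 1))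
  refine (congrArg (fun F => MeasurePreserving F
    ((volume : Measure ℝ).prod (volume : Measure (Eu d))) volume) ?_).mp (h3.comp (h2.comp h1))
  funext p
  simp [snocVec, MeasurableEquiv.piFinSuccAbove, Fin.insertNthEquiv]

theorem measurable_snocVec : Measurable fun p : Eu d × ℝ => snocVec p.1 p.2 :=
  (measurePreserving_snocVec (d := d)).measurable.comp measurable_swap

theorem measurable_snocVec_one : Measurable fun z : Eu d => snocVec z 1 :=
  measurable_snocVec.comp (by fun_prop : Measurable fun z : Eu d => (z, (1 : ℝ)))

theorem measurable_sTilde : Measurable (sTilde : Eu d → Sph d) := by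
  have := measurable_snocVec_one (d := d)
  refine Measurable.subtype_mk ?_
  fun_prop

theorem measurable_vTilde : Measurable fun p : ℝ × Eu d => vTilde p.1 p.2 := by
  have : Measurable fun p : ℝ × Eu d => snocVec p.2 1 :=
    measurable_snocVec_one.comp measurable_snd
  unfold vTilde
  exact measurable_fst.div this.norm

theorem inner_snocVec (z γ : Eu d) (a b : ℝ) :
    inner ℝ (snocVec z a) (snocVec γ b) = inner ℝ z γ + a * b := by
  simp [snocVec, PiLp.inner_apply, Fin.sum_univ_castSucc, mul_comm]

/-- Dividing the selection inequality by the positive norm of `(z', 1)` puts it in half-space form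
with a unit normal. -/
theorem inner_sTilde_lt_vTilde_iff (v θ : ℝ) (z γ : Eu d) :
    inner ℝ (sTilde z : Eu (d + 1)) (snocVec γ θ) < vTilde v z ↔ v - inner ℝ z γ - θ > 0 := by
  have hn : 0 < ‖snocVec z 1‖ := norm_pos_iff.mpr (snocVec_one_ne_zero z)
  have h : inner ℝ (sTilde z : Eu (d + 1)) (snocVec γ θ)
      = (inner ℝ z γ + θ) / ‖snocVec z 1‖ := by
    simp only [sTilde]
    rw [real_inner_smul_left, inner_snocVec, one_mul, div_eq_inv_mul]
  rw [h, vTilde, div_lt_div_iff_of_pos_right hn]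
  constructor <;> intro h <;> linarith

end RescaledInstruments

/-! ### Identification with several unobservables -/

section IdentificationVector

theorem identification_vector {Ω 𝒳 : Type*} [MeasurableSpace Ω] [MeasurableSpace 𝒳]
    (μ : Measure Ω) [IsProbabilityMeasure μ] {Y₀ Y₁ Δ Y D V Θ : Ω → ℝ} {X : Ω → 𝒳}
    (hY₀ : Measurable Y₀) (hY₁ : Measurable Y₁) (hV : Measurable V) (hΘ : Measurable Θ)
    (hX : Measurable X) (hΔ : ∀ ω, Δ ω = Y₁ ω - Y₀ ω) (hY : ∀ ω, Y ω = Y₀ ω + Δ ω * D ω)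
    {d : ℕ} {Z Γ : Ω → Eu d} {S : Ω → Sph d} {Vt : Ω → ℝ} {Γt : Ω → Eu (d + 1)}
    (hZ : Measurable Z) (hΓ : Measurable Γ)
    (hD : ∀ ω, D ω = Set.indicator {ω' | V ω' - inner ℝ (Z ω') (Γ ω') - Θ ω' > 0} 1 ω)
    (hS : ∀ ω, S ω = sTilde (Z ω)) (hVt : ∀ ω, Vt ω = vTilde (V ω) (Z ω))
    (hΓt : ∀ ω, Γt ω = snocVec (Γ ω) (Θ ω))
    (hac : ∀ᵐ x ∂(μ.map X),
      condDistrib (fun ω => (S ω, Vt ω, Y₀ ω, Y₁ ω, Θ ω, Γ ω)) X μ x ≪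
        (sphMeasure d).prod (volume : Measure (ℝ × ℝ × ℝ × ℝ × Eu d)))
    (hi₀ : CondIndepGiven μ (fun ω => (V ω, Z ω)) (fun ω => (Y₀ ω, Γ ω, Θ ω)) X)
    (hi₁ : CondIndepGiven μ (fun ω => (V ω, Z ω)) (fun ω => (Y₁ ω, Γ ω, Θ ω)) X)
    (hlarge : ∀ᵐ x ∂(μ.map X),
      (condDistrib S X μ x).support = closure (Hplus d) ∧
      ∀ᵐ s : Sph d ∂(condDistrib S X μ x), ∀ u : ℝ,
        (⨅ γ ∈ (condDistrib Γt X μ x).support, ((inner ℝ (s : Eu (d + 1)) γ : ℝ) : EReal)) ≤ u →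
        (u : EReal) ≤
          (⨆ γ ∈ (condDistrib Γt X μ x).support, ((inner ℝ (s : Eu (d + 1)) γ : ℝ) : EReal)) →
        u ∈ (condDistrib Vt (fun ω => (S ω, X ω)) μ (s, x)).support)
    (hiΔ : CondIndepGiven μ Y₀ Δ (fun ω => (Γt ω, X ω)))
    (hmem : ∀ᵐ x ∂(μ.map X), ∀ᵐ γ ∂(condDistrib Γt X μ x),
      MemLp (fun δ => UCDITE μ Δ Γt X δ γ x) 2 volume)
    (hchar : ∀ᵐ x ∂(μ.map X), ∀ᵐ γ ∂(condDistrib Γt X μ x),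
      ∀ t : ℝ, charFun (condDistrib Y₀ (fun ω => (Γt ω, X ω)) μ (γ, x)) t ≠ 0) :
    ∀ᵐ x ∂(μ.map X), ∀ᵐ γ ∂(condDistrib Γt X μ x),
      condDistrib Δ (fun ω => (Γt ω, X ω)) μ (γ, x) ≪ volume ∧
      IsFourierInversion (fun δ => UCDITE μ Δ Γt X δ γ x)
        (fun t =>
          invRadon (dvRegressionDir
            (condDistrib (fun ω => (Y ω, D ω, S ω, Vt ω)) X μ x) (treatedWeight t)) γ /
          invRadon (dvRegressionDir
            (condDistrib (fun ω => (Y ω, D ω, S ω, Vt ω)) X μ x) (untreatedWeight t)) γ) := by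
  have hsn := measurable_snocVec (d := d)
  have hst := measurable_sTilde (d := d)
  have hvt := measurable_vTilde (d := d)
  have hΔm : Measurable Δ := by rw [funext hΔ]; fun_prop
  have hSm : Measurable S := by rw [funext hS]; fun_prop
  have hVtm : Measurable Vt := by
    rw [funext hVt]; exact hvt.comp (hV.prodMk hZ)
  have hΓtm : Measurable Γt := by
    rw [funext hΓt]; exact hsn.comp (hΓ.prodMk hΘ)
  -- The primitives keep `(V, Z)`: independence is assumed for this pair, absolute continuity for
  -- the rescaled instruments, and the latter are functions of the former.
  set W : Ω → ℝ × Eu d × ℝ × ℝ × Eu d × ℝ :=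
    fun ω => (V ω, Z ω, Y₀ ω, Y₁ ω, Γ ω, Θ ω) with hWdef
  have hW : Measurable W := by fun_prop
  set S' : ℝ × Eu d × ℝ × ℝ × Eu d × ℝ → Sph d := fun w => sTilde w.2.1 with hS'
  have hS'm : Measurable S' := by fun_prop
  set V' : ℝ × Eu d × ℝ × ℝ × Eu d × ℝ → ℝ := fun w => vTilde w.1 w.2.1 with hV'
  have hV'm : Measurable V' := hvt.comp (by fun_prop :
    Measurable fun w : ℝ × Eu d × ℝ × ℝ × Eu d × ℝ => (w.1, w.2.1))
  set G' : ℝ × Eu d × ℝ × ℝ × Eu d × ℝ → Eu (d + 1) :=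
    fun w => snocVec w.2.2.2.2.1 w.2.2.2.2.2 with hG'
  have hG'm : Measurable G' := hsn.comp (by fun_prop :
    Measurable fun w : ℝ × Eu d × ℝ × ℝ × Eu d × ℝ => (w.2.2.2.2.1, w.2.2.2.2.2))
  set D' : ℝ × Eu d × ℝ × ℝ × Eu d × ℝ → ℝ :=
    {w | inner ℝ (S' w : Eu (d + 1)) (G' w) < V' w}.indicator 1 with hD'
  have hD'm : Measurable D' :=
    measurable_one.indicator (measurableSet_lt (by fun_prop) (by fun_prop))
  set Y' : ℝ × Eu d × ℝ × ℝ × Eu d × ℝ → ℝ :=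
    fun w => w.2.2.1 + (w.2.2.2.1 - w.2.2.1) * D' w with hY'
  have hY'm : Measurable Y' := by fun_prop
  have hDW : ∀ ω, D ω = D' (W ω) := fun ω => by
    rw [hD ω]
    simp only [hD', Set.indicator_apply, mem_ofPred_eq, hS', hG', hV', hWdef,
      inner_sTilde_lt_vTilde_iff, Pi.one_apply]
  have hSW : S = fun ω => S' (W ω) := funext hS
  have hVW : Vt = fun ω => V' (W ω) := funext hVt
  have hGW : Γt = fun ω => G' (W ω) := funext hΓt
  have hobs : (fun ω => (Y ω, D ω, S ω, Vt ω))
      = fun ω => (fun w => (Y' w, D' w, S' w, V' w)) (W ω) := by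
    funext ω
    simp only [hY', hY, hΔ, hDW, hSW, hVW]
    rfl
  have hjoint : (fun ω => (S ω, Vt ω, Y₀ ω, Y₁ ω, Θ ω, Γ ω))
      = fun ω => (fun w : ℝ × Eu d × ℝ × ℝ × Eu d × ℝ =>
        (S' w, V' w, w.2.2.1, w.2.2.2.1, w.2.2.2.2.2, w.2.2.2.2.1)) (W ω) := by
    simp only [hSW, hVW]; rfl
  have hΔW : (fun ω => (Γt ω, Δ ω)) = fun ω => (fun w : ℝ × Eu d × ℝ × ℝ × Eu d × ℝ =>
      (G' w, w.2.2.2.1 - w.2.2.1)) (W ω) := by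
    funext ω; simp only [hΔ, hGW]; rfl
  have h0W : (fun ω => (Γt ω, Y₀ ω)) = fun ω => (fun w : ℝ × Eu d × ℝ × ℝ × Eu d × ℝ =>
      (G' w, w.2.2.1)) (W ω) := by
    simp only [hGW]; rfl
  have h1W : (fun ω => (Γt ω, Y₁ ω)) = fun ω => (fun w : ℝ × Eu d × ℝ × ℝ × Eu d × ℝ =>
      (G' w, w.2.2.2.1)) (W ω) := by
    simp only [hGW]; rfl
  have hSVW : (fun ω => (S ω, Vt ω)) = fun ω => (fun w : ℝ × Eu d × ℝ × ℝ × Eu d × ℝ =>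
      (S' w, V' w)) (W ω) := by
    simp only [hSW, hVW]
  have hchar₁ := ae_ae_of_ae_map_prodMk hΓtm hX
    (ae_charFun_condDistrib_add (Y₁ := Y₁) hY₀ hΔm (fun ω => by rw [hΔ ω]; ring) hiΔ)
  have map := fun {β : Type} [MeasurableSpace β] [StandardBorelSpace β] [Nonempty β]
    {f : ℝ × Eu d × ℝ × ℝ × Eu d × ℝ → β} (hf : Measurable f) =>
    ae_condDistrib_map (μ := μ) (X := X) hW hf
  filter_upwards [hac, hi₀, hi₁, hlarge, hmem, hchar, hchar₁,
    ae_condDistrib_prodMk (μ := μ) hY₀ hΓtm hX, ae_condDistrib_prodMk (μ := μ) hY₁ hΓtm hX,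
    ae_condDistrib_prodMk (μ := μ) hΔm hΓtm hX, ae_condDistrib_prodMk (μ := μ) hVtm hSm hX,
    map (f := fun w => (Y' w, D' w, S' w, V' w)) (by fun_prop),
    map (f := S') hS'm, map (f := G') hG'm,
    map (f := fun w => ((w.1, w.2.1), (w.2.2.1, w.2.2.2.2.1, w.2.2.2.2.2))) (by fun_prop),
    map (f := fun w => ((w.1, w.2.1), (w.2.2.2.1, w.2.2.2.2.1, w.2.2.2.2.2))) (by fun_prop),
    map (f := fun w => (w.1, w.2.1)) (by fun_prop),
    map (f := fun w => (w.2.2.1, w.2.2.2.2.1, w.2.2.2.2.2)) (by fun_prop),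
    map (f := fun w => (w.2.2.2.1, w.2.2.2.2.1, w.2.2.2.2.2)) (by fun_prop),
    map (f := fun w => (S' w, V' w, w.2.2.1, w.2.2.2.1, w.2.2.2.2.2, w.2.2.2.2.1)) (by fun_prop),
    map (f := fun w => (G' w, w.2.2.1)) (by fun_prop),
    map (f := fun w => (G' w, w.2.2.2.1)) (by fun_prop),
    map (f := fun w => (G' w, w.2.2.2.1 - w.2.2.1)) (by fun_prop),
    map (f := fun w => (S' w, V' w)) (by fun_prop)]
    with x hac hi₀ hi₁ hlarge hmem hchar hchar₁ hκ₀ hκ₁ hκΔ hη eobs eS eG ei0 ei1 eVZ e0 e1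
      ejoint eG0 eG1 eGΔ eSV
  rw [← hobs] at eobs
  rw [← hjoint] at ejoint
  rw [← hΔW] at eGΔ
  rw [← h0W] at eG0
  rw [← h1W] at eG1
  rw [← hSVW] at eSV
  rw [← hSW] at eS
  rw [← hGW] at eG
  simp only [hWdef] at eobs eS eG ei0 ei1 eVZ e0 e1 ejoint eG0 eG1 eGΔ eSV
  set P := condDistrib W X μ x with hP
  rw [ejoint] at hac
  rw [ei0, eVZ, e0] at hi₀
  rw [ei1, eVZ, e1] at hi₁
  rw [eG0, eG] at hκ₀
  rw [eG1, eG] at hκ₁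
  rw [eGΔ, eG] at hκΔ
  rw [eSV, eS] at hη
  rw [eS, eG] at hlarge
  rw [eG] at hmem hchar hchar₁ ⊢
  rw [eobs]
  have hWm : Measurable fun w : ℝ × Eu d × ℝ × ℝ × Eu d × ℝ =>
    (S' w, V' w, w.2.2.1, w.2.2.2.1, w.2.2.2.2.2, w.2.2.2.2.1) := by fun_prop
  have hΔac : P.map (fun w => (G' w, w.2.2.2.1 - w.2.2.1)) ≪
      (volume : Measure (Eu (d + 1))).prod (volume : Measure ℝ) := by
    have hq : Measure.QuasiMeasurePreserving
        (Prod.map (fun p : ℝ × Eu d => snocVec p.2 p.1) (id : ℝ → ℝ))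
        ((volume : Measure (ℝ × Eu d)).prod volume) (volume.prod volume) :=
      (measurePreserving_snocVec.prod (MeasurePreserving.id volume)).quasiMeasurePreserving
    -- Forget both instruments, replace the two outcomes by their difference, then stack `Θ` and
    -- `Γ`; each map pulls null sets back to null sets.
    exact absolutelyContinuous_map_of_quasi hWm hac
      (hq.comp ((quasiMeasurePreserving_sub_prod (volume : Measure (ℝ × Eu d))).comp
        (Measure.quasiMeasurePreserving_snd.comp Measure.quasiMeasurePreserving_snd)))
  have hGac : P.map G' ≪ volume := by
    have hm : Measurable fun w : ℝ × Eu d × ℝ × ℝ × Eu d × ℝ => (G' w, w.2.2.2.1 - w.2.2.1) := by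
      fun_prop
    exact absolutelyContinuous_map_of_quasi hm hΔac Measure.quasiMeasurePreserving_fst
  have hf : Measurable fun p : ℝ × Eu d => (sTilde p.2, vTilde p.1 p.2) := by fun_prop
  have hg : Measurable fun p : ℝ × Eu d × ℝ => (snocVec p.2.1 p.2.2, p.1) :=
    (hsn.comp measurable_snd).prodMk measurable_fst
  have hmain := ae_invRadon_dvRegressionDir_eq (P := P) (Y₀ := fun w => w.2.2.1)
    (Y₁ := fun w => w.2.2.2.1) (Y := Y') (D := D') (Vt := V') (S := S') (Γt := G')
    (by fun_prop) (by fun_prop) hV'm hS'm hG'm hY'm hD'm (fun _ => rfl) (fun _ => rfl) hGac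
    (indepFun_map_prodMk (by fun_prop) (by fun_prop) hi₀ hf hg)
    (indepFun_map_prodMk (by fun_prop) (by fun_prop) hi₁ hf hg)
    hκ₀ hκ₁ hη hlarge.1 hlarge.2
  rw [hκΔ] at hΔac
  have : IsProbabilityMeasure (P.map G') := Measure.isProbabilityMeasure_map hG'm.aemeasurable
  filter_upwards [hmain, hmem, hchar, hchar₁, ae_absolutelyContinuous_of_compProd hΔac,
    ae_rnDeriv_toReal_ne_zero hGac] with γ hmain hmem hchar hchar₁ hac hf
  exact ⟨hac, isFourierInversion_div hac hmem hchar₁ hchar hf (fun t => (hmain t).1)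
    (fun t => (hmain t).2)⟩

end IdentificationVector

/-! ### The identification theorem -/

theorem theorem5 {Ω 𝒳 : Type*} [MeasurableSpace Ω] [MeasurableSpace 𝒳] [StandardBorelSpace 𝒳]
    (μ : Measure Ω) [IsProbabilityMeasure μ]
    (Y₀ Y₁ Δ Y D V Θ : Ω → ℝ) (X₀ X₁ X : Ω → 𝒳)
    (hY₀ : Measurable Y₀) (hY₁ : Measurable Y₁) (hV : Measurable V) (hΘ : Measurable Θ)
    (hX₀ : Measurable X₀) (hX₁ : Measurable X₁) (hX : Measurable X)
    -- the outcome equation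
    (hΔ : ∀ ω, Δ ω = Y₁ ω - Y₀ ω)
    (hY : ∀ ω, Y ω = Y₀ ω + Δ ω * D ω)
    -- the control variables are those of the realized state, and are not caused by the treatment
    (hXD : ∀ ω, (D ω = 1 → X ω = X₁ ω) ∧ (D ω = 0 → X ω = X₀ ω))
    (hX01 : X₀ =ᵐ[μ] X₁)
    -- `0 < P(D = 1 | X) < 1`
    (hD01 : ∀ᵐ x ∂(μ.map X), 0 < condDistrib D X μ x {1} ∧ condDistrib D X μ x {1} < 1) :
    -- one scalar unobservable (`L = 1`)
    ((∀ ω, D ω = Set.indicator {ω' | V ω' - Θ ω' > 0} 1 ω) →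
      (∀ᵐ x ∂(μ.map X),
        condDistrib (fun ω => (V ω, Y₀ ω, Y₁ ω, Θ ω)) X μ x ≪ volume) →
      CondIndepGiven μ V (fun ω => (Y₀ ω, Θ ω)) X →
      CondIndepGiven μ V (fun ω => (Y₁ ω, Θ ω)) X →
      CondIndepGiven μ Y₀ Δ (fun ω => (Θ ω, X ω)) →
      (∀ᵐ x ∂(μ.map X), ∀ᵐ θ ∂(condDistrib Θ X μ x),
        MemLp (fun δ => UCDITE μ Δ Θ X δ θ x) 1 volume ∧
        MemLp (fun δ => UCDITE μ Δ Θ X δ θ x) 2 volume) →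
      (∀ᵐ x ∂(μ.map X), ∀ᵐ θ ∂(condDistrib Θ X μ x),
        ∀ t : ℝ, charFun (condDistrib Y₀ (fun ω => (Θ ω, X ω)) μ (θ, x)) t ≠ 0) →
      ∀ᵐ x ∂(μ.map X), ∀ᵐ θ ∂(condDistrib Θ X μ x), θ ∈ (condDistrib V X μ x).support →
        condDistrib Δ (fun ω => (Θ ω, X ω)) μ (θ, x) ≪ volume ∧
        IsFourierInversion (fun δ => UCDITE μ Δ Θ X δ θ x)
          (fun t =>
            dvRegression (condDistrib (fun ω => (Y ω, D ω, V ω)) X μ x) (treatedWeight t) θ /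
            dvRegression (condDistrib (fun ω => (Y ω, D ω, V ω)) X μ x) (untreatedWeight t) θ))
    ∧
    -- several unobservables (`L = d + 1 ≥ 2`)
    (∀ (d : ℕ), 1 ≤ d → ∀ (Z Γ : Ω → Eu d) (S : Ω → Sph d) (Vt : Ω → ℝ) (Γt : Ω → Eu (d + 1)),
      Measurable Z → Measurable Γ →
      (∀ ω, D ω = Set.indicator {ω' | V ω' - inner ℝ (Z ω') (Γ ω') - Θ ω' > 0} 1 ω) →
      -- the rescaled instruments and the vector of unobservables
      (∀ ω, S ω = sTilde (Z ω)) → (∀ ω, Vt ω = vTilde (V ω) (Z ω)) →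
      (∀ ω, Γt ω = snocVec (Γ ω) (Θ ω)) →
      (∀ᵐ x ∂(μ.map X),
        condDistrib (fun ω => (S ω, Vt ω, Y₀ ω, Y₁ ω, Θ ω, Γ ω)) X μ x ≪
          (sphMeasure d).prod (volume : Measure (ℝ × ℝ × ℝ × ℝ × Eu d))) →
      CondIndepGiven μ (fun ω => (V ω, Z ω)) (fun ω => (Y₀ ω, Γ ω, Θ ω)) X →
      CondIndepGiven μ (fun ω => (V ω, Z ω)) (fun ω => (Y₁ ω, Γ ω, Θ ω)) X →
      -- the large support condition
      (∀ᵐ x ∂(μ.map X),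
        (condDistrib S X μ x).support = closure (Hplus d) ∧
        ∀ᵐ s : Sph d ∂(condDistrib S X μ x), ∀ u : ℝ,
          (⨅ γ ∈ (condDistrib Γt X μ x).support, ((inner ℝ (s : Eu (d + 1)) γ : ℝ) : EReal)) ≤ u →
          (u : EReal) ≤
            (⨆ γ ∈ (condDistrib Γt X μ x).support, ((inner ℝ (s : Eu (d + 1)) γ : ℝ) : EReal)) →
          u ∈ (condDistrib Vt (fun ω => (S ω, X ω)) μ (s, x)).support) →
      CondIndepGiven μ Y₀ Δ (fun ω => (Γt ω, X ω)) →
      (∀ᵐ x ∂(μ.map X), ∀ᵐ γ ∂(condDistrib Γt X μ x),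
        MemLp (fun δ => UCDITE μ Δ Γt X δ γ x) 1 volume ∧
        MemLp (fun δ => UCDITE μ Δ Γt X δ γ x) 2 volume) →
      (∀ᵐ x ∂(μ.map X), ∀ᵐ γ ∂(condDistrib Γt X μ x),
        ∀ t : ℝ, charFun (condDistrib Y₀ (fun ω => (Γt ω, X ω)) μ (γ, x)) t ≠ 0) →
      ∀ᵐ x ∂(μ.map X), ∀ᵐ γ ∂(condDistrib Γt X μ x),
        condDistrib Δ (fun ω => (Γt ω, X ω)) μ (γ, x) ≪ volume ∧
        IsFourierInversion (fun δ => UCDITE μ Δ Γt X δ γ x)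
          (fun t =>
            invRadon (dvRegressionDir
              (condDistrib (fun ω => (Y ω, D ω, S ω, Vt ω)) X μ x) (treatedWeight t)) γ /
            invRadon (dvRegressionDir
              (condDistrib (fun ω => (Y ω, D ω, S ω, Vt ω)) X μ x) (untreatedWeight t)) γ)) := by
  refine ⟨fun hD hac hi₀ hi₁ hiΔ hmem hchar => ?_,
    fun d _ Z Γ S Vt Γt hZ hΓ hD hS hVt hΓt hac hi₀ hi₁ hlarge hiΔ hmem hchar => ?_⟩
  · exact identification_scalar μ hY₀ hY₁ hV hΘ hX hΔ hY hD hac hi₀ hi₁ hiΔ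
      (hmem.mono fun x hx => hx.mono fun θ h => h.2) hchar
  · exact identification_vector μ hY₀ hY₁ hV hΘ hX hΔ hY hZ hΓ hD hS hVt hΓt hac hi₀ hi₁ hlarge
      hiΔ (hmem.mono fun x hx => hx.mono fun γ h => h.2) hchar
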